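/- **Theorem (PSDP with signed rewards).** There is an absolute constant $c>0$ with the following property. *Setting.* Let $H,d\in\mathbb N$, let $\mathcal A$ be a finite non-empty action set with $A=|\mathcal A|$, and let $\mathcal X=\mathcal X_1\sqcup\dots\sqcup\mathcal X_H$ be a layered measurable state space with a $\sigma$-finite base measure $\nu$. Consider a low-rank MDP: $\boldsymbol x_1\sim\rho\in\Delta(\mathcal X_1)$ and, for $1\le t<H$, $\boldsymbol x_{t+1}\sim T_t(\cdot\mid \boldsymbol x_t,\boldsymbol a_t)$, where $T_t(\cdot\mid x,a)$ is a probability measure on $\mathcal X_{t+1}$ with the everywhere non-negative $\nu$-density $y\mapsto\mu^\star_{t+1}(y)^\top\phi^\star_t(x,a)$, with measurable $\phi^\star_t:\mathcal X_t\times\mathcal A\to\mathbb R^d$ and $\mu^\star_t:\mathcal X_t\to\mathbb R^d$. Assume for all $t\in[H]$ that $\|\phi^\star_t\|\le1$, that $\mu_t^\star$ is $\nu$-integrable on $\mathcal X_t$, and that $\|\int_{\mathcal X_t}\mu^\star_t\,g\,d\nu\|\le\sqrt d$ for all measurable $g:\mathcal X_t\to[0,1]$. Let $\Pi_{\mathtt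 M}$ be the set of randomized Markov policies $\pi:\mathcal X\to\Delta(\mathcal A)$, $\mathbb E^\pi$ the expectation under $\pi$, and $d^\pi(x)$ for $x\in\mathcal X_t$ the density of the law of $\boldsymbol x_t$ under $\pi$ with respect to $\nu$; for $t\ge2$ it is taken in the version $d^\pi(x)=\mu_t^\star(x)^\top\mathbb E^\pi[\phi^\star_{t-1}(\boldsymbol x_{t-1},\boldsymbol a_{t-1})]$. A distribution $P$ over $\Pi_{\mathtt M}$ is an $(\alpha,\varepsilon)$-randomized policy cover for layer $t$ if $\mathbb E_{\pi\sim P}[d^\pi(x)]\ge\alpha\sup_{\pi'\in\Pi_{\mathtt M}}d^{\pi'}(x)$ for all $x\in\mathcal X_t$ with $\sup_{\pi'\in\Pi_{\mathtt M}}d^{\pi'}(x)\ge\varepsilon\|\mu^\star_t(x)\|$. *Hypotheses.* Let $\alpha,\delta,\varepsilon\in(0,1)$, $B\ge1$, $B_1,\dots,B_h>0$, $h\in[H]$, and let $n\ge1$ be an integer with $n\ge2\delta$. Let $r_t:\mathcal X_t\times\mathcal A\to[-B_t,B_t]$, $t\in[h]$, be measurable, let $\mathcal G_t$, $t\in[h]$,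 be classes of measurable functions $\mathcal X_t\times\mathcal A\to\mathbb R$, and let $P^{(1)},\dots,P^{(h)}$ be distributions over $\Pi_{\mathtt M}$ such that 1. $\mathcal G_{1:h}$ realizes $r_{1:h}$: for all $t\in[h]$ and $\pi\in\Pi_{\mathtt M}$ the function $Q^\pi_t(x,a)=r_t(x,a)+\mathbb E^\pi[\sum_{\ell=t+1}^h r_\ell(\boldsymbol x_\ell,\boldsymbol a_\ell)\mid\boldsymbol x_t=x,\boldsymbol a_t=a]$ belongs to $\mathcal G_t$; 2. the functions in $\mathcal G_{1:h}$ and the regression targets are bounded by $B$: $|g|\le B$ for all $g\in\mathcal G_t$, $t\in[h]$, and, for every $t\in[h]$, $\pi\in\Pi_{\mathtt M}$ and $(x,a)\in\mathcal X_t\times\mathcal A$, $|\sum_{\ell=t}^h r_\ell(\boldsymbol x_\ell,\boldsymbol a_\ell)|\le B$ almost surely under $\pi$ started in layer $t$ from $(\boldsymbol x_t,\boldsymbol a_t)=(x,a)$ (which holds, for instance, if $\sum_{t=1}^hB_t\le B$); 3. for each $t\in[h]$, $P^{(t)}$ is an $(\alpha,\varepsilon)$-randomized policy cover for layer $t$.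 *Algorithm.* $\mathtt{PSDP}(h,r_{1:h},\mathcal G_{1:h},P^{(1:h)},n)$ proceeds for $t=h,\dots,1$ as follows. It draws $n$ independent samples $(x,a,R)$ of $(\boldsymbol x_t,\boldsymbol a_t,\sum_{\ell=t}^hr_\ell(\boldsymbol x_\ell,\boldsymbol a_\ell))$, for each of them drawing $\pi\sim P^{(t)}$ and playing $\pi$ in the layers before $t$, a uniformly random action in layer $t$, and $\hat\pi$ (as already determined) in the layers $t+1,\dots,h$; it picks $\hat g^{(t)}\in\operatorname{argmin}_{g\in\mathcal G_t}\sum_{(x,a,R)}(g(x,a)-R)^2$ and sets $\hat\pi(x)\in\operatorname{argmax}_{a\in\mathcal A}\hat g^{(t)}(x,a)$ for $x\in\mathcal X_t$, with any (measurable) choice among minimizers and maximizers. It returns $\hat\pi$. *Conclusion.* With probability at least $1-\delta$, the returned policy satisfies $$\sup_{\pi\in\Pi_{\mathtt M}}\mathbb E^\pi\Big[\sum_{t=1}^hr_t(\boldsymbol x_t,\boldsymbol a_t)\Big]\le\mathbb E^{\hat\pi}\Big[\sum_{t=1}^hr_t(\boldsymbol x_t,\boldsymbol a_t)\Big]+cH\sqrt{\frac{B^2A}{\alpha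 n}\Big(\max_{t\in[h]}\ln\mathcal N_{\mathcal G_t}(1/n)+\ln\frac n\delta\Big)}+2\varepsilon h\,d^{3/2}\sum_{t=1}^hB_t,$$ where $\mathcal N_{\mathcal G}(\eta)$ is the smallest number of functions $g_1,\dots,g_N$ such that every $g\in\mathcal G$ has $\|g-g_i\|_\infty\le\eta$ for some $i$ (if some $\mathcal N_{\mathcal G_t}(1/n)$ is infinite the bound is void). -/

import Mathlib

open MeasureTheory ProbabilityTheory

noncomputable section

namespace LowRank

/-- A layered low-rank MDP with horizon `H`, feature dimension `d` and action space `A`. Layers are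
numbered `0, …, H - 1`, and the state space is the disjoint union of the types `X 0, …, X (H - 1)`
(nothing is required of `X t` for `t ≥ H`). `ν t` is the restriction of the base measure to layer
`t`, and `y ↦ ⟪μ (t + 1) y, φ t x a⟫` is the density of the transition law from `(x, a)`. -/
structure MDP (X : ℕ → Type*) [∀ t, MeasurableSpace (X t)] (A : Type*) [MeasurableSpace A]
    (d H : ℕ) where
  ρ : Measure (X 0)
  T : ∀ t, Kernel (X t × A) (X (t + 1))
  ν : ∀ t, Measure (X t)
  φ : ∀ t, X t → A → EuclideanSpace ℝ (Fin d)
  μ : ∀ t, X t → EuclideanSpace ℝ (Fin d)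
  prob_ρ : IsProbabilityMeasure ρ
  markov_T : ∀ t, t + 1 < H → IsMarkovKernel (T t)
  sigmaFinite_ν : ∀ t, t < H → SigmaFinite (ν t)
  measurable_φ : ∀ t, t < H → Measurable (fun p : X t × A => φ t p.1 p.2)
  measurable_μ : ∀ t, t < H → Measurable (μ t)
  density_nonneg : ∀ t, t + 1 < H → ∀ x a y, 0 ≤ inner ℝ (μ (t + 1) y) (φ t x a)
  T_eq : ∀ t, t + 1 < H → ∀ x a,
    T t (x, a) = (ν (t + 1)).withDensity fun y => ENNReal.ofReal (inner ℝ (μ (t + 1) y) (φ t x a))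
  norm_φ_le : ∀ t, t < H → ∀ x a, ‖φ t x a‖ ≤ 1
  integrable_μ : ∀ t, t < H → Integrable (μ t) (ν t)
  norm_μ_le : ∀ t, t < H → ∀ g : X t → ℝ, Measurable g → (∀ x, g x ∈ Set.Icc (0 : ℝ) 1) →
    ‖∫ x, g x • μ t x ∂(ν t)‖ ≤ √(d : ℝ)

/-- A randomized Markov policy: a law on actions for every state. -/
structure Policy (X : ℕ → Type*) [∀ t, MeasurableSpace (X t)] (A : Type*) [MeasurableSpace A] where
  ker : ∀ t, Kernel (X t) A
  markov : ∀ t, IsMarkovKernel (ker t)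

/-- A probability distribution over Markov policies: an index `θ` is drawn from `law` and the policy
`x ↦ ker t (θ, x)` is played. -/
structure PolicyDist (X : ℕ → Type*) [∀ t, MeasurableSpace (X t)] (A : Type*)
    [MeasurableSpace A] where
  Θ : Type*
  mΘ : MeasurableSpace Θ
  law : Measure Θ
  prob : IsProbabilityMeasure law
  ker : ∀ t, Kernel (Θ × X t) A
  markov : ∀ t, IsMarkovKernel (ker t)

variable {X : ℕ → Type*} [∀ t, MeasurableSpace (X t)] {A : Type*} [MeasurableSpace A] {d H : ℕ}

instance (P : PolicyDist X A) : MeasurableSpace P.Θ := P.mΘ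

/-- The policy with index `θ`. -/
def PolicyDist.policy (P : PolicyDist X A) (θ : P.Θ) : Policy X A where
  ker t := (P.ker t).comap (fun x => (θ, x)) measurable_prodMk_left
  markov t := by
    have := P.markov t
    infer_instance

/-- The policy that draws actions uniformly at random. -/
def unifPolicy (X : ℕ → Type*) [∀ t, MeasurableSpace (X t)] (A : Type*) [MeasurableSpace A]
    [Fintype A] [Nonempty A] : Policy X A where
  ker _ := Kernel.const _ (PMF.uniformOfFintype A).toMeasure
  markov _ := inferInstance

/-- The deterministic policy that plays `act t x` in state `x` of layer `t`. -/
def detPolicy (act : ∀ t, X t → A) (hact : ∀ t, Measurable (act t)) : Policy X A where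
  ker t := Kernel.deterministic (act t) (hact t)
  markov _ := inferInstance

/-- `π ∘_t π'`: play `π` in the layers before `t` and `π'` from layer `t` on. -/
def Policy.splice (π : Policy X A) (t : ℕ) (π' : Policy X A) : Policy X A where
  ker ℓ := if ℓ < t then π.ker ℓ else π'.ker ℓ
  markov ℓ := by
    have := π.markov ℓ
    have := π'.markov ℓ
    split_ifs <;> infer_instance

namespace MDP

/-- The law of the state `x_t` under the policy `π`. -/
def stateLaw (M : MDP X A d H) (π : Policy X A) : (t : ℕ) → Measure (X t)
  | 0 => M.ρ
  | t + 1 => (stateLaw M π t).bind fun x => (π.ker t x).bind fun a => M.T t (x, a)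

/-- The law of `r_t(x_t, a_t) + ⋯ + r_{t+k}(x_{t+k}, a_{t+k})` when the episode is started in layer
`t` with `x_t = x` and `a_t = a` and later actions are drawn from `π`. -/
def returnLaw (M : MDP X A d H) (π : Policy X A) (r : ∀ t, X t → A → ℝ) :
    ℕ → (t : ℕ) → X t → A → Measure ℝ
  | 0, t, x, a => Measure.dirac (r t x a)
  | k + 1, t, x, a =>
    ((M.T t (x, a)).bind fun y => (π.ker (t + 1) y).bind fun b =>
      returnLaw M π r k (t + 1) y b).map fun R => r t x a + R

/-- The law of `(x_t, a_t, ∑_{t ≤ ℓ < h} r_ℓ(x_ℓ, a_ℓ))` under the policy `π`, for `t < h`. -/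
def obsLaw (M : MDP X A d H) (π : Policy X A) (r : ∀ t, X t → A → ℝ) (h t : ℕ) :
    Measure (X t × A × ℝ) :=
  (M.stateLaw π t).bind fun x => (π.ker t x).bind fun a =>
    (M.returnLaw π r (h - 1 - t) t x a).map fun R => (x, a, R)

/-- The expected total reward of `π` over the first `h` layers, for `1 ≤ h`. -/
def value (M : MDP X A d H) (π : Policy X A) (r : ∀ t, X t → A → ℝ) (h : ℕ) : ℝ :=
  ∫ z, z.2.2 ∂(M.obsLaw π r h 0)

/-- The Q-function of `π` in layer `t < h`: the conditional expectation of
`∑_{t ≤ ℓ < h} r_ℓ(x_ℓ, a_ℓ)` given `x_t = x` and `a_t = a`. -/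
def Q (M : MDP X A d H) (π : Policy X A) (r : ∀ t, X t → A → ℝ) (h t : ℕ) (x : X t) (a : A) : ℝ :=
  ∫ R, R ∂(M.returnLaw π r (h - 1 - t) t x a)

/-- The occupancy density `d^π`, that is, the density of `M.stateLaw π t` with respect to `M.ν t`.
After the first layer the low-rank structure singles out the version
`x ↦ 𝔼^π[⟪μ_{t+1}(x), φ_t(x_t, a_t)⟫]`, which is defined in every point; see
`MDP.stateLaw_succ_eq_withDensity`. -/
def occ (M : MDP X A d H) (π : Policy X A) : (t : ℕ) → X t → ℝ
  | 0, x => (M.ρ.rnDeriv (M.ν 0) x).toReal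
  | t + 1, x => ∫ y, ∫ a, inner ℝ (M.μ (t + 1) x) (M.φ t y a) ∂(π.ker t y) ∂(M.stateLaw π t)

theorem stateLaw_succ (M : MDP X A d H) (π : Policy X A) (t : ℕ) (ht : t + 1 < H)
    [IsProbabilityMeasure (M.stateLaw π t)] :
    M.stateLaw π (t + 1) = ((M.stateLaw π t) ⊗ₘ (π.ker t)).bind (M.T t) := by
  have := M.markov_T t ht
  have := π.markov t
  have hm : Measurable fun x : X t => (π.ker t x).bind fun a => M.T t (x, a) := by
    refine Measure.measurable_of_measurable_coe _ fun s hs => ?_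
    have h1 : ∀ x : X t, ((π.ker t x).bind fun a => M.T t (x, a)) s
        = ∫⁻ a, M.T t (x, a) s ∂(π.ker t x) := fun x =>
      Measure.bind_apply hs ((M.T t).measurable.comp measurable_prodMk_left).aemeasurable
    simp_rw [h1]
    exact ((M.T t).measurable_coe hs).lintegral_kernel_prod_right'
  ext s hs
  rw [stateLaw, Measure.bind_apply hs hm.aemeasurable,
    Measure.bind_apply hs (M.T t).measurable.aemeasurable,
    Measure.lintegral_compProd ((M.T t).measurable_coe hs)]
  refine lintegral_congr fun x => ?_
  exact Measure.bind_apply hs ((M.T t).measurable.comp measurable_prodMk_left).aemeasurable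

theorem isProbabilityMeasure_stateLaw (M : MDP X A d H) (π : Policy X A) (t : ℕ) (ht : t < H) :
    IsProbabilityMeasure (M.stateLaw π t) := by
  induction t with
  | zero => exact M.prob_ρ
  | succ t ih =>
    have := ih (by omega)
    have := M.markov_T t ht
    have := π.markov t
    rw [M.stateLaw_succ π t ht]
    infer_instance

/-- The law of `x_{t+1}` has density `M.occ π (t + 1)` with respect to the base measure. -/
theorem stateLaw_succ_eq_withDensity (M : MDP X A d H) (π : Policy X A) (t : ℕ) (ht : t + 1 < H) :
    M.stateLaw π (t + 1) =
      (M.ν (t + 1)).withDensity fun x => ENNReal.ofReal (M.occ π (t + 1) x) := by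
  have := M.isProbabilityMeasure_stateLaw π t (by omega)
  have := M.markov_T t ht
  have := π.markov t
  have := M.sigmaFinite_ν (t + 1) ht
  have hφ := M.measurable_φ t (by omega)
  have hμ := M.measurable_μ (t + 1) ht
  have hf : Measurable fun q : (X t × A) × X (t + 1) =>
      inner ℝ (M.μ (t + 1) q.2) (M.φ t q.1.1 q.1.2) :=
    (hμ.comp measurable_snd).inner (hφ.comp measurable_fst)
  rw [M.stateLaw_succ π t ht]
  ext s hs
  rw [Measure.bind_apply hs (M.T t).measurable.aemeasurable, withDensity_apply _ hs]
  have h1 : ∀ p : X t × A, M.T t p s = ∫⁻ y in s,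
      ENNReal.ofReal (inner ℝ (M.μ (t + 1) y) (M.φ t p.1 p.2)) ∂(M.ν (t + 1)) := fun p => by
    rw [← withDensity_apply _ hs, ← M.T_eq t ht p.1 p.2]
  simp_rw [h1]
  rw [lintegral_lintegral_swap hf.ennreal_ofReal.aemeasurable]
  refine lintegral_congr fun y => ?_
  have hi : Integrable (fun p : X t × A => inner ℝ (M.μ (t + 1) y) (M.φ t p.1 p.2))
      ((M.stateLaw π t) ⊗ₘ (π.ker t)) := by
    refine Integrable.of_bound (hf.comp measurable_prodMk_right).aestronglyMeasurable
      ‖M.μ (t + 1) y‖ (ae_of_all _ fun p => ?_)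
    refine (norm_inner_le_norm _ _).trans ?_
    exact mul_le_of_le_one_right (norm_nonneg _) (M.norm_φ_le t (by omega) p.1 p.2)
  rw [occ, ← Measure.integral_compProd hi, ofReal_integral_eq_lintegral_ofReal hi]
  exact ae_of_all _ fun p => M.density_nonneg t ht p.1 p.2 y

/-- `P` is an `(α, ε)`-randomized policy cover for layer `t`. -/
def IsPolicyCover (M : MDP X A d H) (P : PolicyDist X A) (α ε : ℝ) (t : ℕ) : Prop :=
  ∀ x : X t, ε * ‖M.μ t x‖ ≤ (⨆ π : Policy X A, M.occ π t x) →
    α * (⨆ π : Policy X A, M.occ π t x) ≤ ∫ θ, M.occ (P.policy θ) t x ∂P.law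

/-- The function classes `G 0, …, G (h - 1)` realize the rewards. -/
def Realizes (M : MDP X A d H) (G : ∀ t, Set (X t → A → ℝ)) (r : ∀ t, X t → A → ℝ) (h : ℕ) :
    Prop :=
  ∀ t, t < h → ∀ π : Policy X A, M.Q π r h t ∈ G t

/-- The law of one sample of PSDP in layer `t`: draw `π ∼ P`, play `π` before layer `t`, a uniform
action in layer `t` and `π'` afterwards, and record `(x_t, a_t, ∑_{t ≤ ℓ < h} r_ℓ(x_ℓ, a_ℓ))`. -/
def sampleLaw [Fintype A] [Nonempty A] (M : MDP X A d H) (P : PolicyDist X A) (π' : Policy X A)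
    (r : ∀ t, X t → A → ℝ) (h t : ℕ) : Measure (X t × A × ℝ) :=
  P.law.bind fun θ =>
    M.obsLaw (((P.policy θ).splice t (unifPolicy X A)).splice (t + 1) π') r h t

end MDP

/-- The covering number of a class `G` of functions in `ℓ_∞`-distance at scale `ε`; it is `⊤` if
there is no finite cover. -/
def coveringNumber {S A : Type*} (G : Set (S → A → ℝ)) (ε : ℝ) : ℕ∞ :=
  ⨅ (N : ℕ) (_ : ∃ c : Fin N → S → A → ℝ, ∀ g ∈ G, ∃ i, ∀ x a, |g x a - c i x a| ≤ ε), (N : ℕ∞)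

/-- An execution of `PSDP(h, r, G, P, n)` on a probability space `(Ω, Pr)`. The layers are processed
in the order `t = h - 1, …, 0`; `hist t` is the information available once layer `t` has been
processed (it contains the data sets and the choices made among minimizers and maximizers in the
layers `t, …, h - 1`). -/
structure PSDPRun [Fintype A] [Nonempty A] (M : MDP X A d H) (h : ℕ) (r : ∀ t, X t → A → ℝ)
    (G : ∀ t, Set (X t → A → ℝ)) (P : ℕ → PolicyDist X A) (n : ℕ)
    {Ω : Type*} [mΩ : MeasurableSpace Ω] (Pr : Measure Ω) where
  hist : ℕ → MeasurableSpace Ω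
  hist_le : ∀ t, hist t ≤ mΩ
  hist_succ_le : ∀ t, hist (t + 1) ≤ hist t
  /-- the data set of layer `t` -/
  data : ∀ t : Fin h, Ω → Fin n → X t × A × ℝ
  /-- the regression function of layer `t` -/
  ghat : ∀ t : Fin h, Ω → X t → A → ℝ
  /-- the action of the learned policy in the states of layer `t` -/
  act : ∀ t, Ω → X t → A
  measurable_data : ∀ t : Fin h, Measurable[hist t] (data t)
  measurable_act : ∀ t ω, Measurable (act t ω)
  measurable_act_uncurry : ∀ t,
    @Measurable (Ω × X t) A ((hist t).prod inferInstance) _ fun p => act t p.1 p.2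
  /-- Given the past, the data set of layer `t` consists of `n` independent samples. -/
  data_law : ∀ t : Fin h, ∀ E, MeasurableSet[hist ((t : ℕ) + 1)] E → ∀ S, MeasurableSet S →
    Pr (E ∩ data t ⁻¹' S) = ∫⁻ ω in E, Measure.pi (fun _ : Fin n =>
      M.sampleLaw (P t) (detPolicy (fun ℓ => act ℓ ω) (fun ℓ => measurable_act ℓ ω)) r h t) S ∂Pr
  ghat_mem : ∀ (t : Fin h) ω, ghat t ω ∈ G t
  ghat_le : ∀ t : Fin h, ∀ ω, ∀ g ∈ G t,
    ∑ i, (ghat t ω (data t ω i).1 (data t ω i).2.1 - (data t ω i).2.2) ^ 2 ≤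
      ∑ i, (g (data t ω i).1 (data t ω i).2.1 - (data t ω i).2.2) ^ 2
  ghat_act : ∀ t : Fin h, ∀ ω x a, ghat t ω x a ≤ ghat t ω x (act t ω x)

/-- The policy returned by the run (its values in the layers `t ≥ h` are irrelevant). -/
def PSDPRun.output [Fintype A] [Nonempty A] {M : MDP X A d H} {h : ℕ} {r : ∀ t, X t → A → ℝ}
    {G : ∀ t, Set (X t → A → ℝ)} {P : ℕ → PolicyDist X A} {n : ℕ}
    {Ω : Type*} [MeasurableSpace Ω] {Pr : Measure Ω} (run : PSDPRun M h r G P n Pr) (ω : Ω) :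
    Policy X A :=
  detPolicy (fun t => run.act t ω) (fun t => run.measurable_act t ω)

end LowRank

end

/-!
By the performance difference lemma the regret of `π̂` against `π` is the sum over the layers `t` of
the expected advantage of `π` over `π̂` under the law of `x_t` given by `π`.

Split the states of layer `t` by whether `P⁽ᵗ⁾` covers `d^π` with ratio `α`. On the covered states
change measure to the sampling law, at the cost of a factor `α⁻¹`; as `π̂` is greedy for `ĝ⁽ᵗ⁾`, the
advantage is at most twice the pointwise error of `ĝ⁽ᵗ⁾` as an estimate of the Q-function of `π̂`,
and the mean square of this error is `O(B² Λ / n)`, where `Λ` is the sum of the two logarithms. This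
fast rate comes from a one-sided Bernstein bound for the excess loss over a `1/n`-net. It applies
because `π̂` in the layers after `t`, hence the regression target, is determined before the data of
layer `t` is drawn.

On the set `C` of uncovered states one has `d^π < ε ‖μ⋆_t‖`, so its probability `p` is at most
`ε ∫_C ‖μ⋆_t‖`. Averaging `|⟪μ⋆_t, g⟫|` over a standard Gaussian vector `g` turns the bounds
`‖∫_S μ⋆_t‖ ≤ √d` into one for `∫_C ‖μ⋆_t‖`. The two parts of `C` on which `⟪μ⋆_t, g⟫` has a fixed
sign cost `2 √d` if estimated separately; the parallelogram identity, applied to the integrals over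
their complements, saves enough to reach `∫_C ‖μ⋆_t‖ ≤ (1 + p) d^{3/2}`. No state of the first layer
is uncovered, and this spare layer absorbs the factor `1 + p` when the probabilities are added up,
which yields the constant `2` in `2 ε h d^{3/2} ∑ B_t`.
-/

namespace LowRank

section Measurability

variable {Θ Y Z : Type*} [MeasurableSpace Θ] [MeasurableSpace Y] [MeasurableSpace Z]

theorem measurable_bind_param {μ : Θ → Measure Y} (hμ : Measurable μ)
    [∀ θ, IsProbabilityMeasure (μ θ)] {f : Θ → Y → Measure Z}
    (hf : Measurable fun p : Θ × Y => f p.1 p.2) :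
    Measurable fun θ => (μ θ).bind (f θ) := by
  let κ : Kernel Θ Y := ⟨μ, hμ⟩
  have : IsMarkovKernel κ := ⟨fun θ => inferInstanceAs (IsProbabilityMeasure (μ θ))⟩
  refine Measure.measurable_of_measurable_coe _ fun s hs => ?_
  have hbind (θ : Θ) : ((μ θ).bind (f θ)) s = ∫⁻ y, f θ y s ∂(κ θ) :=
    Measure.bind_apply hs (hf.comp measurable_prodMk_left).aemeasurable
  simp_rw [hbind]
  exact ((Measure.measurable_coe hs).comp hf).lintegral_kernel_prod_right'

theorem measurable_map_param {μ : Θ → Measure Y} (hμ : Measurable μ)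
    [∀ θ, IsProbabilityMeasure (μ θ)] {f : Θ → Y → Z}
    (hf : Measurable fun p : Θ × Y => f p.1 p.2) :
    Measurable fun θ => (μ θ).map (f θ) := by
  have hmap (θ : Θ) : (μ θ).map (f θ) = (μ θ).bind fun y => Measure.dirac (f θ y) :=
    (Measure.bind_dirac_eq_map _ (hf.comp measurable_prodMk_left)).symm
  simp_rw [hmap]
  exact measurable_bind_param hμ (Measure.measurable_dirac.comp hf)

theorem measurable_pi_param {ι : Type*} [Fintype ι] {μ : Θ → Measure Y} (hμ : Measurable μ)
    [∀ θ, IsProbabilityMeasure (μ θ)] :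
    Measurable fun θ => Measure.pi fun _ : ι => μ θ := by
  refine Measurable.measure_of_isPiSystem_of_isProbabilityMeasure generateFrom_pi.symm
    isPiSystem_pi ?_
  rintro _ ⟨s, hs, rfl⟩
  simp only [Measure.pi_pi]
  exact Finset.measurable_prod _ fun i _ =>
    (Measure.measurable_coe (hs i (Set.mem_univ i))).comp hμ

theorem measurable_compProd_sectR (τ : Measure Y) [SFinite τ] (K : Kernel (Θ × Y) Z)
    [IsSFiniteKernel K] : Measurable fun θ => τ ⊗ₘ K.sectR θ := by
  convert (Kernel.const Θ τ ⊗ₖ K).measurable using 2 with θ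
  rw [Kernel.compProd_apply_eq_compProd_sectR, Kernel.const_apply]

theorem map_prodMk_eq_compProd_of_conditional_law {Ω : Type*} [MeasurableSpace Ω] {Pr : Measure Ω}
    [IsFiniteMeasure Pr] {p : Ω → Θ} (hp : Measurable p) {f : Ω → Y} (hf : Measurable f)
    (K : Kernel Θ Y) [IsFiniteKernel K]
    (hlaw : ∀ E, MeasurableSet E → ∀ S, MeasurableSet S →
      Pr (p ⁻¹' E ∩ f ⁻¹' S) = ∫⁻ ω in p ⁻¹' E, K (p ω) S ∂Pr) :
    Pr.map (fun ω => (p ω, f ω)) = (Pr.map p) ⊗ₘ K := by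
  refine Measure.ext_prod fun {s t} hs ht => ?_
  rw [Measure.map_apply (hp.prodMk hf) (hs.prod ht), Measure.compProd_apply_prod hs ht,
    setLIntegral_map hs (K.measurable_coe ht) hp]
  exact hlaw s hs t ht

theorem measure_preimage_le_of_conditional_law {Ω : Type*} [MeasurableSpace Ω] {Pr : Measure Ω}
    [IsProbabilityMeasure Pr] {p : Ω → Θ} (hp : Measurable p) {f : Ω → Y} (hf : Measurable f)
    (K : Kernel Θ Y) [IsFiniteKernel K]
    (hlaw : ∀ E, MeasurableSet E → ∀ S, MeasurableSet S →
      Pr (p ⁻¹' E ∩ f ⁻¹' S) = ∫⁻ ω in p ⁻¹' E, K (p ω) S ∂Pr)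
    {U : Set (Θ × Y)} (hU : MeasurableSet U) {η : ENNReal}
    (hη : ∀ θ, K θ (Prod.mk θ ⁻¹' U) ≤ η) : Pr {ω | (p ω, f ω) ∈ U} ≤ η := by
  have : IsProbabilityMeasure (Pr.map p) := Measure.isProbabilityMeasure_map hp.aemeasurable
  calc Pr {ω | (p ω, f ω) ∈ U} = Pr.map (fun ω => (p ω, f ω)) U :=
        (Measure.map_apply (hp.prodMk hf) hU).symm
    _ = ∫⁻ θ, K θ (Prod.mk θ ⁻¹' U) ∂(Pr.map p) := by
        rw [map_prodMk_eq_compProd_of_conditional_law hp hf K hlaw, Measure.compProd_apply hU]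
    _ ≤ ∫⁻ _, η ∂(Pr.map p) := lintegral_mono hη
    _ = η := by simp

end Measurability

section Concentration

variable {Z : Type*} [MeasurableSpace Z] {ν : Measure Z} [IsProbabilityMeasure ν] {Y : Z → ℝ}

theorem abs_integral_le_of_ae {C : ℝ} (hC : ∀ᵐ z ∂ν, |Y z| ≤ C) : |∫ z, Y z ∂ν| ≤ C := by
  simpa using norm_integral_le_of_norm_le_const (μ := ν) (f := Y) (C := C) (by simpa using hC)

theorem integrable_exp_neg_of_abs_le_one (hY : Measurable Y) (hY1 : ∀ᵐ z ∂ν, |Y z| ≤ 1) :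
    Integrable (fun z => Real.exp (-Y z)) ν := by
  refine Integrable.of_bound (by fun_prop) (Real.exp 1) ?_
  filter_upwards [hY1] with z hz
  rw [Real.norm_eq_abs, Real.abs_exp, Real.exp_le_exp]
  linarith [(abs_le.1 hz).1]

theorem integral_exp_neg_le (hY : Measurable Y) (hY1 : ∀ᵐ z ∂ν, |Y z| ≤ 1)
    (hvar : ∫ z, Y z ^ 2 ∂ν ≤ (∫ z, Y z ∂ν) / 2) :
    ∫ z, Real.exp (-Y z) ∂ν ≤ Real.exp (-((∫ z, Y z ∂ν) / 2)) := by
  have hYi : Integrable Y ν := .of_bound hY.aestronglyMeasurable 1 hY1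
  have hY2i : Integrable (fun z => Y z ^ 2) ν :=
    .of_bound (by fun_prop) 1 (by
      filter_upwards [hY1] with z hz
      rw [norm_pow]
      exact pow_le_one₀ (norm_nonneg _) hz)
  calc ∫ z, Real.exp (-Y z) ∂ν
      ≤ ∫ z, (1 - Y z + Y z ^ 2) ∂ν := by
        refine integral_mono_ae (integrable_exp_neg_of_abs_le_one hY hY1) (by fun_prop) ?_
        filter_upwards [hY1] with z hz
        have := (abs_le.1 (Real.abs_exp_sub_one_sub_id_le (x := -Y z) (by rwa [abs_neg]))).2
        linarith [neg_sq (Y z)]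
    _ = 1 - ∫ z, Y z ∂ν + ∫ z, Y z ^ 2 ∂ν := by
        rw [integral_add (by fun_prop) hY2i, integral_sub (by fun_prop) hYi]
        simp
    _ ≤ -((∫ z, Y z ∂ν) / 2) + 1 := by linarith
    _ ≤ Real.exp (-((∫ z, Y z ∂ν) / 2)) := Real.add_one_le_exp _

/-- A one-sided Bernstein bound: as the variance is controlled by the mean, the empirical sum falls
below half of its expectation only by an additive constant. -/
theorem measure_pi_sum_add_le_half_mean (hY : Measurable Y) (hY1 : ∀ᵐ z ∂ν, |Y z| ≤ 1)
    (hvar : ∫ z, Y z ^ 2 ∂ν ≤ (∫ z, Y z ∂ν) / 2) (ι : Type*) [Fintype ι] (L : ℝ) :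
    Measure.pi (fun _ : ι => ν)
        {z | ∑ k, Y (z k) + L ≤ Fintype.card ι * ((∫ z, Y z ∂ν) / 2)}
      ≤ ENNReal.ofReal (Real.exp (-L)) := by
  set m := (∫ z, Y z ∂ν) / 2
  set N := (Fintype.card ι : ℝ)
  have hexp (z : ι → Z) : Real.exp (1 * -∑ k, Y (z k)) = ∏ k, Real.exp (-Y (z k)) := by
    rw [one_mul, ← Finset.sum_neg_distrib, Real.exp_sum]
  have hmgf : mgf (fun z => -∑ k, Y (z k)) (Measure.pi fun _ : ι => ν) 1 ≤ Real.exp (-(N * m)) := by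
    simp only [mgf, hexp]
    rw [integral_fintype_prod_eq_pow (fun z => Real.exp (-Y z)),
      show -(N * m) = Fintype.card ι * -m by ring, Real.exp_nat_mul]
    exact pow_le_pow_left₀ (integral_nonneg fun z => (Real.exp_pos _).le)
      (integral_exp_neg_le hY hY1 hvar) _
  have hint : Integrable (fun z : ι → Z => Real.exp (1 * -∑ k, Y (z k)))
      (Measure.pi fun _ : ι => ν) := by
    simp only [hexp]
    exact Integrable.fintype_prod fun _ => integrable_exp_neg_of_abs_le_one hY hY1
  have hset : {z : ι → Z | ∑ k, Y (z k) + L ≤ N * m} = {z | L - N * m ≤ -∑ k, Y (z k)} := by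
    ext z
    simp only [Set.mem_ofPred_eq]
    constructor <;> intro h <;> linarith
  rw [hset, ENNReal.le_ofReal_iff_toReal_le (measure_ne_top _ _) (Real.exp_pos _).le]
  calc _ ≤ Real.exp (-1 * (L - N * m)) * mgf (fun z => -∑ k, Y (z k)) (Measure.pi fun _ => ν) 1 :=
        measure_ge_le_exp_mul_mgf _ zero_le_one hint
    _ ≤ Real.exp (-1 * (L - N * m)) * Real.exp (-(N * m)) := by gcongr
    _ = Real.exp (-L) := by rw [← Real.exp_add]; ring_nf

end Concentration

section Regression

variable {Θ W : Type*} [MeasurableSpace Θ] [MeasurableSpace W]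

/-- The excess squared loss of the predictor `g` over the predictor `q` at the sample `z`. -/
def excessLoss {W : Type*} (g q : W → ℝ) (z : W × ℝ) : ℝ := (g z.1 - z.2) ^ 2 - (q z.1 - z.2) ^ 2

theorem excessLoss_eq_mul {W : Type*} (g q : W → ℝ) (z : W × ℝ) :
    excessLoss g q z = (g z.1 + q z.1 - 2 * z.2) * (g z.1 - q z.1) := by
  unfold excessLoss; ring

theorem measurable_excessLoss {g q : W → ℝ} (hg : Measurable g) (hq : Measurable q) :
    Measurable (excessLoss g q) := by
  unfold excessLoss; fun_prop

theorem abs_sub_le_two_mul {B a b : ℝ} (ha : |a| ≤ B) (hb : |b| ≤ B) : |a - b| ≤ 2 * B := by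
  linarith [abs_sub a b]

theorem abs_add_sub_two_mul_le {B a b c : ℝ} (ha : |a| ≤ B) (hb : |b| ≤ B) (hc : |c| ≤ B) :
    |a + b - 2 * c| ≤ 4 * B := by
  rw [abs_le] at *; constructor <;> linarith

theorem integrable_sq_sub {Z : Type*} [MeasurableSpace Z] {ν : Measure Z} [IsFiniteMeasure ν]
    {B : ℝ} {f g : Z → ℝ} (hf : Measurable f) (hg : Measurable g) (hfB : ∀ z, |f z| ≤ B)
    (hgB : ∀ z, |g z| ≤ B) : Integrable (fun z => (f z - g z) ^ 2) ν := by
  refine .of_bound (by fun_prop) ((2 * B) ^ 2) (ae_of_all _ fun z => ?_)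
  rw [norm_pow]
  exact pow_le_pow_left₀ (norm_nonneg _) (abs_sub_le_two_mul (hfB z) (hgB z)) 2

section FixedConditionalLaw

variable {τ : Measure W} {K : Kernel W ℝ} [IsMarkovKernel K] {B : ℝ} {g : W → ℝ}

theorem measurable_kernel_mean (K : Kernel W ℝ) : Measurable fun w => ∫ R, R ∂(K w) :=
  (measurable_id.stronglyMeasurable.integral_kernel (κ := K)).measurable

theorem ae_abs_snd_le [SFinite τ] (hR : ∀ w, ∀ᵐ R ∂(K w), |R| ≤ B) :
    ∀ᵐ z ∂(τ ⊗ₘ K), |z.2| ≤ B := by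
  rw [Measure.ae_compProd_iff (p := fun z : W × ℝ => |z.2| ≤ B)
    (measurableSet_le (by fun_prop) (by fun_prop))]
  exact ae_of_all _ hR

theorem ae_abs_excessLoss_le [SFinite τ] (hR : ∀ w, ∀ᵐ R ∂(K w), |R| ≤ B) (hgB : ∀ w, |g w| ≤ B) :
    ∀ᵐ z ∂(τ ⊗ₘ K), |excessLoss g (fun w => ∫ R, R ∂(K w)) z| ≤ 8 * B ^ 2 := by
  filter_upwards [ae_abs_snd_le hR] with z hz
  have hq := abs_integral_le_of_ae (hR z.1)
  rw [excessLoss_eq_mul, abs_mul]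
  calc _ ≤ (4 * B) * (2 * B) := by
        gcongr
        · linarith [abs_nonneg (g z.1), hgB z.1]
        · exact abs_add_sub_two_mul_le (hgB z.1) hq hz
        · exact abs_sub_le_two_mul (hgB z.1) hq
    _ = _ := by ring

theorem integral_excessLoss [IsFiniteMeasure τ] (hR : ∀ w, ∀ᵐ R ∂(K w), |R| ≤ B) (hg : Measurable g)
    (hgB : ∀ w, |g w| ≤ B) :
    ∫ z, excessLoss g (fun w => ∫ R, R ∂(K w)) z ∂(τ ⊗ₘ K)
      = ∫ w, (g w - ∫ R, R ∂(K w)) ^ 2 ∂τ := by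
  rw [Measure.integral_compProd (.of_bound
    (measurable_excessLoss hg (measurable_kernel_mean K)).aestronglyMeasurable _
    (ae_abs_excessLoss_le hR hgB))]
  refine integral_congr_ae (ae_of_all _ fun w => ?_)
  have hRi : Integrable (fun R : ℝ => R) (K w) := .of_bound (by fun_prop) B (hR w)
  set q := fun w => ∫ R, R ∂(K w)
  have hlin (R : ℝ) : excessLoss g q (w, R) = (g w ^ 2 - q w ^ 2) - 2 * (g w - q w) * R := by
    unfold excessLoss; ring
  simp_rw [hlin]
  rw [integral_sub (integrable_const _) (hRi.const_mul _), integral_const_mul]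
  simp only [integral_const, probReal_univ, one_smul]
  change g w ^ 2 - q w ^ 2 - 2 * (g w - q w) * q w = (g w - q w) ^ 2
  ring

theorem integral_excessLoss_sq_le [IsFiniteMeasure τ] (hR : ∀ w, ∀ᵐ R ∂(K w), |R| ≤ B)
    (hg : Measurable g) (hgB : ∀ w, |g w| ≤ B) :
    ∫ z, excessLoss g (fun w => ∫ R, R ∂(K w)) z ^ 2 ∂(τ ⊗ₘ K)
      ≤ 16 * B ^ 2 * ∫ w, (g w - ∫ R, R ∂(K w)) ^ 2 ∂τ := by
  have hq := measurable_kernel_mean K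
  have hqB (w : W) := abs_integral_le_of_ae (hR w)
  have hbound := ae_abs_excessLoss_le (τ := τ) hR hgB
  set q := fun w => ∫ R, R ∂(K w)
  have hfst : ∫ w, (g w - q w) ^ 2 ∂τ = ∫ z, (g z.1 - q z.1) ^ 2 ∂(τ ⊗ₘ K) := by
    conv_lhs => rw [← Measure.fst_compProd τ K]
    rw [Measure.fst, integral_map measurable_fst.aemeasurable (by fun_prop)]
  have hint : Integrable (fun z => excessLoss g q z ^ 2) (τ ⊗ₘ K) := by
    refine .of_bound ((measurable_excessLoss hg hq).pow_const 2).aestronglyMeasurable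
      ((8 * B ^ 2) ^ 2) ?_
    filter_upwards [hbound] with z hz
    rw [norm_pow]
    exact pow_le_pow_left₀ (norm_nonneg _) hz 2
  change _ ≤ 16 * B ^ 2 * ∫ w, (g w - q w) ^ 2 ∂τ
  rw [hfst, ← integral_const_mul]
  refine integral_mono_ae hint ((integrable_sq_sub (hg.comp measurable_fst)
    (hq.comp measurable_fst) (fun z => hgB z.1) fun z => hqB z.1).const_mul _) ?_
  filter_upwards [ae_abs_snd_le hR] with z hz
  rw [excessLoss_eq_mul, mul_pow]
  gcongr
  calc _ = |g z.1 + q z.1 - 2 * z.2| ^ 2 := (sq_abs _).symm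
    _ ≤ (4 * B) ^ 2 := pow_le_pow_left₀ (abs_nonneg _)
        (abs_add_sub_two_mul_le (hgB z.1) (hqB z.1) hz) 2
    _ = _ := by ring

end FixedConditionalLaw

/-- The event on which least squares over the finite class `g` works for the data `z`: the targets
are bounded by `B`, and the squared distance of every `g i` from the regression function `q` is
controlled by its empirical excess loss. -/
def IsConcentrated (τ : Measure W) (q : W → ℝ) {n N : ℕ} (g : Fin N → W → ℝ) (B L : ℝ)
    (z : Fin n → W × ℝ) : Prop :=
  (∀ k, |(z k).2| ≤ B) ∧ ∀ i, n * ∫ w, (g i w - q w) ^ 2 ∂τ ≤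
    2 * ∑ k, excessLoss (g i) q (z k) + 64 * B ^ 2 * L

variable {τ : Measure W} {n N : ℕ} {g : Fin N → W → ℝ} {B L : ℝ}

theorem measurableSet_isConcentrated [SFinite τ] {q : Θ → W → ℝ}
    (hq : Measurable fun v : Θ × W => q v.1 v.2) (hg : ∀ i, Measurable (g i)) :
    MeasurableSet {v : Θ × (Fin n → W × ℝ) | IsConcentrated τ (q v.1) g B L v.2} := by
  have herr (i : Fin N) : Measurable fun θ => ∫ w, (g i w - q θ w) ^ 2 ∂τ :=
    (((hg i).comp measurable_snd).sub hq |>.pow_const 2).stronglyMeasurable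
      |>.integral_prod_right' (ν := τ) |>.measurable
  have hloss (i : Fin N) (k : Fin n) :
      Measurable fun v : Θ × (Fin n → W × ℝ) => excessLoss (g i) (q v.1) (v.2 k) := by
    have : Measurable fun v : Θ × (Fin n → W × ℝ) => q v.1 (v.2 k).1 :=
      hq.comp (measurable_fst.prodMk (by fun_prop))
    have hgi := hg i
    unfold excessLoss
    fun_prop
  simp only [IsConcentrated, Set.ofPred_and, Set.ofPred_forall]
  refine .inter (.iInter fun k => ?_) (.iInter fun i => ?_)
  · exact measurableSet_le (by fun_prop) (by fun_prop)
  · exact measurableSet_le (((herr i).comp measurable_fst).const_mul _)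
      (((Finset.measurable_sum _ fun k _ => hloss i k).const_mul 2).add_const _)

theorem measure_pi_excessLoss_deviation_le [IsProbabilityMeasure τ] {K : Kernel W ℝ}
    [IsMarkovKernel K] (hB : 0 < B) (hR : ∀ w, ∀ᵐ R ∂(K w), |R| ≤ B) {g : W → ℝ}
    (hg : Measurable g) (hgB : ∀ w, |g w| ≤ B) :
    Measure.pi (fun _ : Fin n => τ ⊗ₘ K)
        {z | 2 * ∑ k, excessLoss g (fun w => ∫ R, R ∂(K w)) (z k) + 64 * B ^ 2 * L
          < n * ∫ w, (g w - ∫ R, R ∂(K w)) ^ 2 ∂τ}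
      ≤ ENNReal.ofReal (Real.exp (-L)) := by
  have hq := measurable_kernel_mean K
  have hmean := integral_excessLoss (τ := τ) hR hg hgB
  have hvar := integral_excessLoss_sq_le (τ := τ) hR hg hgB
  have hbound := ae_abs_excessLoss_le (τ := τ) hR hgB
  set q := fun w => ∫ R, R ∂(K w)
  -- After division by `32 B²` the variance of the excess loss is at most half of its mean.
  let Y (z : W × ℝ) : ℝ := excessLoss g q z / (32 * B ^ 2)
  have hYmean : ∫ z, Y z ∂(τ ⊗ₘ K) = (∫ w, (g w - q w) ^ 2 ∂τ) / (32 * B ^ 2) := by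
    rw [integral_div, hmean]
  have hY1 : ∀ᵐ z ∂(τ ⊗ₘ K), |Y z| ≤ 1 := by
    filter_upwards [hbound] with z hz
    rw [abs_div, abs_of_pos (by positivity : 0 < 32 * B ^ 2), div_le_one (by positivity)]
    nlinarith [sq_nonneg B]
  have hYvar : ∫ z, Y z ^ 2 ∂(τ ⊗ₘ K) ≤ (∫ z, Y z ∂(τ ⊗ₘ K)) / 2 := by
    simp_rw [hYmean, Y, div_pow]
    rw [integral_div, div_div, div_le_div_iff₀ (by positivity) (by positivity)]
    calc _ ≤ (16 * B ^ 2 * ∫ w, (g w - q w) ^ 2 ∂τ) * (32 * B ^ 2 * 2) := by gcongr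
      _ = _ := by ring
  refine (measure_mono fun z hz => ?_).trans (measure_pi_sum_add_le_half_mean
    ((measurable_excessLoss hg hq).div_const _) hY1 hYvar (Fin n) L)
  rw [Set.mem_ofPred_eq, hYmean, Fintype.card_fin, ← Finset.sum_div]
  field_simp
  linarith [Set.mem_ofPred_eq ▸ hz]

theorem measure_pi_not_isConcentrated_le [IsProbabilityMeasure τ] {K : Kernel W ℝ}
    [IsMarkovKernel K] (hB : 0 < B) (hR : ∀ w, ∀ᵐ R ∂(K w), |R| ≤ B)
    (hg : ∀ i, Measurable (g i)) (hgB : ∀ i w, |g i w| ≤ B) :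
    Measure.pi (fun _ : Fin n => τ ⊗ₘ K)
        {z | ¬ IsConcentrated τ (fun w => ∫ R, R ∂(K w)) g B L z}
      ≤ N * ENNReal.ofReal (Real.exp (-L)) := by
  set q := fun w => ∫ R, R ∂(K w)
  let large (k : Fin n) : Set (Fin n → W × ℝ) := {z | ¬ |(z k).2| ≤ B}
  let deviates (i : Fin N) : Set (Fin n → W × ℝ) :=
    {z | 2 * ∑ k, excessLoss (g i) q (z k) + 64 * B ^ 2 * L < n * ∫ w, (g i w - q w) ^ 2 ∂τ}
  have hcover : {z | ¬ IsConcentrated τ q g B L z} ⊆ (⋃ k, large k) ∪ ⋃ i, deviates i := by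
    intro z hz
    simp only [IsConcentrated, Set.mem_ofPred_eq, not_and_or, not_forall, not_le] at hz
    simpa only [large, deviates, Set.mem_union, Set.mem_iUnion, Set.mem_ofPred_eq, not_le]
  have hlarge : Measure.pi (fun _ : Fin n => τ ⊗ₘ K) (⋃ k, large k) = 0 := by
    rw [measure_iUnion_null_iff]
    exact fun k => (Measure.tendsto_eval_ae_ae (μ := fun _ : Fin n => τ ⊗ₘ K) (i := k)).eventually
      (ae_abs_snd_le hR)
  calc _ ≤ Measure.pi (fun _ : Fin n => τ ⊗ₘ K) (⋃ k, large k)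
        + Measure.pi (fun _ : Fin n => τ ⊗ₘ K) (⋃ i, deviates i) :=
        (measure_mono hcover).trans (measure_union_le _ _)
    _ ≤ 0 + ∑ i, Measure.pi (fun _ : Fin n => τ ⊗ₘ K) (deviates i) :=
        add_le_add hlarge.le (measure_iUnion_fintype_le _ _)
    _ ≤ 0 + ∑ _i : Fin N, ENNReal.ofReal (Real.exp (-L)) := by
        gcongr with i
        exact measure_pi_excessLoss_deviation_le hB hR (hg i) (hgB i)
    _ = _ := by simp

theorem measure_not_isConcentrated_le {Ω : Type*} [MeasurableSpace Ω] {Pr : Measure Ω}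
    [IsProbabilityMeasure Pr] {p : Ω → Θ} (hp : Measurable p)
    {data : Ω → Fin n → W × ℝ} (hdata : Measurable data)
    [IsProbabilityMeasure τ] {K : Kernel (Θ × W) ℝ} [IsMarkovKernel K]
    (hlaw : ∀ E, MeasurableSet E → ∀ S, MeasurableSet S →
      Pr (p ⁻¹' E ∩ data ⁻¹' S) =
        ∫⁻ ω in p ⁻¹' E, Measure.pi (fun _ : Fin n => τ ⊗ₘ K.sectR (p ω)) S ∂Pr)
    (hB : 0 < B) (hR : ∀ v, ∀ᵐ R ∂(K v), |R| ≤ B) (hg : ∀ i, Measurable (g i))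
    (hgB : ∀ i w, |g i w| ≤ B) :
    Pr {ω | ¬ IsConcentrated τ (fun w => ∫ R, R ∂(K (p ω, w))) g B L (data ω)}
      ≤ N * ENNReal.ofReal (Real.exp (-L)) := by
  let Kpi : Kernel Θ (Fin n → W × ℝ) :=
    ⟨fun θ => Measure.pi fun _ => τ ⊗ₘ K.sectR θ,
      measurable_pi_param (measurable_compProd_sectR τ K)⟩
  have : IsMarkovKernel Kpi :=
    ⟨fun θ => inferInstanceAs (IsProbabilityMeasure (Measure.pi fun _ => τ ⊗ₘ K.sectR θ))⟩
  refine measure_preimage_le_of_conditional_law hp hdata Kpi hlaw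
    (measurableSet_isConcentrated (q := fun θ w => ∫ R, R ∂(K (θ, w)))
      (measurable_kernel_mean K) hg).compl fun θ => ?_
  exact measure_pi_not_isConcentrated_le (K := K.sectR θ) hB (fun w => hR (θ, w)) hg hgB

theorem sum_excessLoss_le_of_empirical_minimizer {W : Type*} {q f ghat : W → ℝ} {η : ℝ}
    (hf : ∀ w, |f w| ≤ B) (hghat : ∀ w, |ghat w| ≤ B) {z : Fin n → W × ℝ}
    (hz : ∀ k, |(z k).2| ≤ B)
    (hmin : ∑ k, (ghat (z k).1 - (z k).2) ^ 2 ≤ ∑ k, (q (z k).1 - (z k).2) ^ 2)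
    (hη : ∀ w, |ghat w - f w| ≤ η) :
    ∑ k, excessLoss f q (z k) ≤ n * (4 * B * η) := by
  calc ∑ k, excessLoss f q (z k)
      = ∑ k, (f (z k).1 - (z k).2) ^ 2 - ∑ k, (q (z k).1 - (z k).2) ^ 2 :=
        Finset.sum_sub_distrib ..
    _ ≤ ∑ k, (f (z k).1 - (z k).2) ^ 2 - ∑ k, (ghat (z k).1 - (z k).2) ^ 2 := by gcongr
    _ = ∑ k, excessLoss f ghat (z k) := (Finset.sum_sub_distrib ..).symm
    _ ≤ ∑ _k : Fin n, 4 * B * η := by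
        refine Finset.sum_le_sum fun k _ => (le_abs_self _).trans ?_
        rw [excessLoss_eq_mul, abs_mul, abs_sub_comm (f _)]
        gcongr
        · linarith [abs_nonneg (z k).2, hz k]
        · exact abs_add_sub_two_mul_le (hf _) (hghat _) (hz k)
        · exact hη _
    _ = n * (4 * B * η) := by simp

theorem integral_sq_sub_le_of_abs_sub_le [IsProbabilityMeasure τ] {q f ghat : W → ℝ} {η : ℝ}
    (hf : Measurable f) (hq : Measurable q) (hghat : Measurable ghat)
    (hfB : ∀ w, |f w| ≤ B) (hqB : ∀ w, |q w| ≤ B) (hghatB : ∀ w, |ghat w| ≤ B)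
    (hη : ∀ w, |ghat w - f w| ≤ η) :
    ∫ w, (ghat w - q w) ^ 2 ∂τ ≤ 2 * (∫ w, (f w - q w) ^ 2 ∂τ) + 2 * η ^ 2 := by
  have hint := (integrable_sq_sub (ν := τ) hf hq hfB hqB).const_mul 2
  calc ∫ w, (ghat w - q w) ^ 2 ∂τ ≤ ∫ w, (2 * (f w - q w) ^ 2 + 2 * η ^ 2) ∂τ := by
        refine integral_mono (integrable_sq_sub hghat hq hghatB hqB)
          (hint.add (integrable_const _)) fun w => ?_
        have hsq : (ghat w - f w) ^ 2 ≤ η ^ 2 := by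
          rw [← sq_abs]; exact pow_le_pow_left₀ (abs_nonneg _) (hη w) 2
        linarith [sq_nonneg ((ghat w - f w) - (f w - q w)),
          show (ghat w - q w) ^ 2 = 2 * (f w - q w) ^ 2 + 2 * (ghat w - f w) ^ 2
            - ((ghat w - f w) - (f w - q w)) ^ 2 by ring]
    _ = _ := by
        rw [integral_add hint (integrable_const _), integral_const_mul]
        simp

theorem IsConcentrated.integral_sq_sub_le (hn : 1 ≤ n) [IsProbabilityMeasure τ] (hB : 1 ≤ B)
    {q ghat : W → ℝ} (hg : ∀ i, Measurable (g i)) (hq : Measurable q) (hghat : Measurable ghat)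
    (hgB : ∀ i w, |g i w| ≤ B) (hqB : ∀ w, |q w| ≤ B) (hghatB : ∀ w, |ghat w| ≤ B)
    {z : Fin n → W × ℝ} (hz : IsConcentrated τ q g B L z)
    (hmin : ∑ k, (ghat (z k).1 - (z k).2) ^ 2 ≤ ∑ k, (q (z k).1 - (z k).2) ^ 2)
    (hnet : ∃ i, ∀ w, |ghat w - g i w| ≤ 2 / n) :
    n * ∫ w, (ghat w - q w) ^ 2 ∂τ ≤ 40 * B ^ 2 + 128 * B ^ 2 * L := by
  obtain ⟨i, hi⟩ := hnet
  have hn1 : (1 : ℝ) ≤ n := by exact_mod_cast hn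
  have : (0 : ℝ) < n := by linarith
  have hemp : ∑ k, excessLoss (g i) q (z k) ≤ 8 * B := by
    refine (sum_excessLoss_le_of_empirical_minimizer (hgB i) hghatB hz.1 hmin hi).trans_eq ?_
    field_simp; norm_num
  have hround : n * (2 * (2 / n : ℝ) ^ 2) ≤ 8 := by
    rw [show n * (2 * (2 / n : ℝ) ^ 2) = 8 / n by field_simp; norm_num]
    exact div_le_self (by norm_num) hn1
  calc n * ∫ w, (ghat w - q w) ^ 2 ∂τ
      ≤ n * (2 * (∫ w, (g i w - q w) ^ 2 ∂τ) + 2 * (2 / n) ^ 2) := by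
        gcongr
        exact integral_sq_sub_le_of_abs_sub_le (hg i) hq hghat (hgB i) hqB hghatB hi
    _ ≤ 2 * (2 * (8 * B) + 64 * B ^ 2 * L) + 8 := by linarith [hz.2 i]
    _ ≤ _ := by nlinarith

end Regression

section StandardGaussian

theorem integral_abs_gaussianReal_zero (v : NNReal) :
    ∫ x, |x| ∂(gaussianReal 0 v) = √(2 / Real.pi) * √v := by
  rcases eq_or_ne v 0 with rfl | hv
  · simp
  have : (0 : ℝ) < v := by positivity
  have := Real.pi_pos
  have hdens (x : ℝ) : gaussianPDFReal 0 v x • |x|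
      = (√(2 * Real.pi * v))⁻¹ * (|x| * Real.exp (-(1 / (2 * v)) * |x| ^ 2)) := by
    simp only [gaussianPDFReal, sub_zero, smul_eq_mul, sq_abs]
    ring_nf
  have hIoi : ∫ x in Set.Ioi (0 : ℝ), x * Real.exp (-(1 / (2 * v)) * x ^ 2) = v := by
    have h := integral_rpow_mul_exp_neg_mul_rpow (p := 2) (q := 1) (b := 1 / (2 * v)) (by norm_num)
      (by norm_num) (by positivity)
    norm_num [Real.rpow_neg_one] at h
    simpa [mul_assoc, mul_left_comm 2 (v : ℝ)] using h
  rw [integral_gaussianReal_eq_integral_smul hv]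
  simp_rw [hdens]
  rw [integral_const_mul,
    integral_comp_abs (f := fun x : ℝ => x * Real.exp (-(1 / (2 * v)) * x ^ 2)), hIoi,
    inv_mul_eq_div, div_eq_iff (by positivity), mul_assoc, ← Real.sqrt_mul (by positivity),
    ← Real.sqrt_mul (by positivity),
    show 2 / Real.pi * (v * (2 * Real.pi * v)) = (2 * v : ℝ) ^ 2 by field_simp,
    Real.sqrt_sq (by positivity)]

variable {E : Type*} [NormedAddCommGroup E] [InnerProductSpace ℝ E] [FiniteDimensional ℝ E]
  [MeasurableSpace E] [BorelSpace E]

theorem map_inner_stdGaussian (v : E) :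
    (stdGaussian E).map (fun g => inner ℝ v g) = gaussianReal 0 (‖v‖₊ ^ 2) := by
  have h := IsGaussian.map_eq_gaussianReal (μ := stdGaussian E) (innerSL ℝ v)
  rw [integral_strongDual_stdGaussian, variance_dual_stdGaussian, innerSL_apply_norm] at h
  refine h.trans (congrArg _ ?_)
  ext
  simp

theorem integral_abs_inner_stdGaussian (v : E) :
    ∫ g, |inner ℝ v g| ∂(stdGaussian E) = √(2 / Real.pi) * ‖v‖ := by
  rw [← integral_map (φ := fun g => inner ℝ v g) (f := fun x : ℝ => |x|) (by fun_prop)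
    (by fun_prop), map_inner_stdGaussian, integral_abs_gaussianReal_zero]
  simp

theorem integral_inner_sq_stdGaussian (v : E) :
    ∫ g, inner ℝ v g ^ 2 ∂(stdGaussian E) = ‖v‖ ^ 2 := by
  have h := variance_dual_stdGaussian (innerSL ℝ v)
  rw [variance_of_integral_eq_zero (by fun_prop) (integral_strongDual_stdGaussian _),
    innerSL_apply_norm] at h
  exact h

theorem integrable_inner_sq_stdGaussian (v : E) :
    Integrable (fun g => inner ℝ v g ^ 2) (stdGaussian E) :=
  (IsGaussian.memLp_dual (stdGaussian E) (innerSL ℝ v) 2 (by norm_num)).integrable_sq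

theorem integral_norm_sq_stdGaussian :
    ∫ g : E, ‖g‖ ^ 2 ∂(stdGaussian E) = Module.finrank ℝ E := by
  let b := stdOrthonormalBasis ℝ E
  simp_rw [← b.sum_sq_inner_right]
  rw [integral_finsetSum _ fun i _ => integrable_inner_sq_stdGaussian (b i)]
  simp [integral_inner_sq_stdGaussian, b.norm_eq_one]

theorem integral_norm_sub_inner_smul_stdGaussian_le {e : E} (he : ‖e‖ = 1) :
    ∫ g, ‖g - inner ℝ e g • e‖ ∂(stdGaussian E) ≤ √(Module.finrank ℝ E - 1 : ℝ) := by
  have hpyth (g : E) : ‖g - inner ℝ e g • e‖ ^ 2 = ‖g‖ ^ 2 - inner ℝ e g ^ 2 := by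
    rw [norm_sub_sq_real, inner_smul_right, norm_smul, he, real_inner_comm, mul_one,
      Real.norm_eq_abs, sq_abs]
    ring
  have hL2 : MemLp (fun g : E => g - inner ℝ e g • e) 2 (stdGaussian E) := by
    have hid := IsGaussian.memLp_two_id (μ := stdGaussian E)
    exact hid.sub ((innerSL ℝ e).smulRight e |>.comp_memLp' hid)
  have hvar := variance_nonneg (fun g : E => ‖g - inner ℝ e g • e‖) (stdGaussian E)
  rw [variance_eq_sub hL2.norm] at hvar
  refine Real.le_sqrt_of_sq_le ((sub_nonneg.1 hvar).trans_eq ?_)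
  simp only [Pi.pow_apply, hpyth]
  rw [integral_sub IsGaussian.memLp_two_fun_id.norm.integrable_sq
    (integrable_inner_sq_stdGaussian e), integral_norm_sq_stdGaussian,
    integral_inner_sq_stdGaussian, he, one_pow]

end StandardGaussian

section VariationBound

variable {Y : Type*} [MeasurableSpace Y] {ν : Measure Y}
  {E : Type*} [NormedAddCommGroup E] [InnerProductSpace ℝ E] {μ : Y → E} {φ : E} {b : ℝ}

theorem inner_integral_left [CompleteSpace E] (hμ : Integrable μ ν) (φ : E) :
    inner ℝ (∫ y, μ y ∂ν) φ = ∫ y, inner ℝ (μ y) φ ∂ν := by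
  simp_rw [real_inner_comm φ]
  exact (integral_inner hμ φ).symm

/-- The parallelogram identity for `∫ μ - ∫_{C ∩ S} μ` and `∫ μ - ∫_{C \ S} μ`, whose sum has inner
product at least `2 - p` with `φ`. -/
theorem norm_setIntegral_inter_sub_setIntegral_diff_le [CompleteSpace E] (hμ : Integrable μ ν)
    (hb : ∀ s, MeasurableSet s → ‖∫ y in s, μ y ∂ν‖ ≤ b) (hφ : ‖φ‖ ≤ 1)
    (hone : ∫ y, inner ℝ (μ y) φ ∂ν = 1) {C S : Set Y} (hC : MeasurableSet C)
    (hS : MeasurableSet S) :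
    ‖(∫ y in C ∩ S, μ y ∂ν) - ∫ y in C \ S, μ y ∂ν‖
      ≤ 2 * √(b ^ 2 - 1 + ∫ y in C, inner ℝ (μ y) φ ∂ν) := by
  set total := ∫ y, μ y ∂ν
  set u := ∫ y in C ∩ S, μ y ∂ν
  set v := ∫ y in C \ S, μ y ∂ν
  set p := ∫ y in C, inner ℝ (μ y) φ ∂ν
  have hu : ‖total - u‖ ≤ b := by
    rw [← setIntegral_compl (hC.inter hS) hμ]
    exact hb _ (hC.inter hS).compl
  have hv : ‖total - v‖ ≤ b := by
    rw [← setIntegral_compl (hC.diff hS) hμ]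
    exact hb _ (hC.diff hS).compl
  have htotal : inner ℝ total φ = 1 := by rw [← hone, inner_integral_left hμ]
  have hp : inner ℝ (u + v) φ = p := by
    rw [integral_inter_add_sdiff hS hμ.integrableOn, inner_integral_left hμ.integrableOn]
  have hlower : (2 - p) ^ 2 ≤ ‖(total - u) + (total - v)‖ ^ 2 := by
    have hinner : inner ℝ ((total - u) + (total - v)) φ = 2 - p := by
      rw [← hp, inner_add_left, inner_sub_left, inner_sub_left, inner_add_left, htotal]
      ring
    rw [← hinner, sq_le_sq, abs_norm]
    exact (abs_real_inner_le_norm _ _).trans (mul_le_of_le_one_right (norm_nonneg _) hφ)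
  have hpar := parallelogram_law_with_norm ℝ (total - u) (total - v)
  rw [sub_sub_sub_cancel_left, norm_sub_rev v u] at hpar
  refine abs_le_of_sq_le_sq' ?_ (by positivity) |>.2
  rw [mul_pow, Real.sq_sqrt] <;>
  nlinarith [sq_nonneg p, mul_self_le_mul_self (norm_nonneg _) hu,
    mul_self_le_mul_self (norm_nonneg _) hv, mul_self_nonneg ‖u - v‖]

theorem abs_inner_setIntegral_inter_sub_setIntegral_diff_le [CompleteSpace E]
    (hμ : Integrable μ ν) (hpos : ∀ y, 0 ≤ inner ℝ (μ y) φ) {C S : Set Y} (hS : MeasurableSet S) :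
    |inner ℝ ((∫ y in C ∩ S, μ y ∂ν) - ∫ y in C \ S, μ y ∂ν) φ|
      ≤ ∫ y in C, inner ℝ (μ y) φ ∂ν := by
  have hsplit := integral_inter_add_sdiff (s := C) hS (hμ.inner_const (𝕜 := ℝ) φ).integrableOn
  rw [inner_sub_left, inner_integral_left hμ.integrableOn, inner_integral_left hμ.integrableOn,
    abs_le]
  constructor <;>
  linarith [setIntegral_nonneg_of_ae_restrict (s := C ∩ S) (μ := ν) (ae_of_all _ hpos),
    setIntegral_nonneg_of_ae_restrict (s := C \ S) (μ := ν) (ae_of_all _ hpos)]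

theorem setIntegral_abs_inner_eq [CompleteSpace E] (hμ : Integrable μ ν) (g : E) {C S : Set Y}
    (hC : MeasurableSet C) (hS : MeasurableSet S) (hSg : ∀ y, y ∈ S ↔ 0 ≤ inner ℝ (μ y) g) :
    ∫ y in C, |inner ℝ (μ y) g| ∂ν
      = inner ℝ ((∫ y in C ∩ S, μ y ∂ν) - ∫ y in C \ S, μ y ∂ν) g := by
  rw [inner_sub_left, inner_integral_left hμ.integrableOn, inner_integral_left hμ.integrableOn,
    sub_eq_add_neg, ← integral_neg,
    ← integral_inter_add_sdiff hS (hμ.inner_const g).abs.integrableOn]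
  congr 1
  · exact setIntegral_congr_fun (hC.inter hS) fun y hy => abs_of_nonneg ((hSg y).1 hy.2)
  · exact setIntegral_congr_fun (hC.diff hS) fun y hy =>
      abs_of_neg (not_le.1 fun h => hy.2 ((hSg y).2 h))

theorem setIntegral_abs_inner_le [CompleteSpace E] [MeasurableSpace E] [BorelSpace E]
    [SecondCountableTopology E] (hμm : Measurable μ) (hμ : Integrable μ ν)
    (hb : ∀ s, MeasurableSet s → ‖∫ y in s, μ y ∂ν‖ ≤ b) (hφ : ‖φ‖ ≤ 1)
    (hpos : ∀ y, 0 ≤ inner ℝ (μ y) φ) (hone : ∫ y, inner ℝ (μ y) φ ∂ν = 1) {C : Set Y}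
    (hC : MeasurableSet C) (g : E) :
    ∫ y in C, |inner ℝ (μ y) g| ∂ν
      ≤ |inner ℝ (‖φ‖⁻¹ • φ) g| * ((∫ y in C, inner ℝ (μ y) φ ∂ν) * b)
        + ‖g - inner ℝ (‖φ‖⁻¹ • φ) g • (‖φ‖⁻¹ • φ)‖
          * (2 * √(b ^ 2 - 1 + ∫ y in C, inner ℝ (μ y) φ ∂ν)) := by
  have hS : MeasurableSet {y | 0 ≤ inner ℝ (μ y) g} :=
    measurableSet_le measurable_const (hμm.inner_const (c := g))
  rw [setIntegral_abs_inner_eq hμ g hC hS fun _ => Iff.rfl]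
  have hnorm := norm_setIntegral_inter_sub_setIntegral_diff_le hμ hb hφ hone hC hS
  have hinner := abs_inner_setIntegral_inter_sub_setIntegral_diff_le (C := C) hμ hpos hS
  set e := ‖φ‖⁻¹ • φ
  set v := (∫ y in C ∩ {y | 0 ≤ inner ℝ (μ y) g}, μ y ∂ν)
    - ∫ y in C \ {y | 0 ≤ inner ℝ (μ y) g}, μ y ∂ν
  have hinv : ‖φ‖⁻¹ ≤ b := by
    have hle : 1 ≤ b * ‖φ‖ := by
      calc 1 = inner ℝ (∫ y, μ y ∂ν) φ := by rw [← hone, inner_integral_left hμ]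
        _ ≤ ‖∫ y, μ y ∂ν‖ * ‖φ‖ := real_inner_le_norm _ _
        _ ≤ b * ‖φ‖ := by
          gcongr
          simpa using hb Set.univ .univ
    have hφ0 : 0 < ‖φ‖ := (norm_nonneg _).lt_of_ne fun h => by norm_num [← h] at hle
    exact inv_le_of_inv_le₀ (pos_of_mul_pos_left (by linarith) hφ0.le)
      (by rwa [inv_le_iff_one_le_mul₀' (pos_of_mul_pos_left (by linarith) hφ0.le)])
  have hve : |inner ℝ v e| ≤ (∫ y in C, inner ℝ (μ y) φ ∂ν) * b := by
    rw [inner_smul_right, abs_mul, abs_of_nonneg (by positivity), mul_comm]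
    gcongr
    exact (abs_nonneg _).trans hinner
  calc inner ℝ v g = inner ℝ e g * inner ℝ v e + inner ℝ v (g - inner ℝ e g • e) := by
        rw [inner_sub_right, real_inner_smul_right v e]; ring
    _ ≤ |inner ℝ e g| * |inner ℝ v e| + ‖v‖ * ‖g - inner ℝ e g • e‖ :=
        add_le_add ((le_abs_self _).trans_eq (abs_mul _ _)) (real_inner_le_norm _ _)
    _ ≤ _ := by
        rw [mul_comm ‖v‖]
        gcongr

variable [FiniteDimensional ℝ E] [MeasurableSpace E] [BorelSpace E]

theorem integral_integral_abs_inner_stdGaussian [SFinite ν] (hμ : Integrable μ ν) :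
    ∫ g, ∫ y, |inner ℝ (μ y) g| ∂ν ∂(stdGaussian E) = √(2 / Real.pi) * ∫ y, ‖μ y‖ ∂ν := by
  have hprod : Integrable (fun q : E × Y => |inner ℝ (μ q.2) q.1|) ((stdGaussian E).prod ν) := by
    have hbound := (IsGaussian.memLp_id (stdGaussian E) 1 (by simp)).integrable le_rfl
      |>.norm.mul_prod hμ.norm
    have hmeas : AEStronglyMeasurable (fun q : E × Y => inner ℝ (μ q.2) q.1)
        ((stdGaussian E).prod ν) := hμ.1.comp_snd.inner aestronglyMeasurable_id.comp_fst
    refine hbound.mono (continuous_abs.comp_aestronglyMeasurable hmeas) (ae_of_all _ fun q => ?_)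
    rw [norm_mul, norm_norm, norm_norm, norm_abs_eq_norm, mul_comm]
    exact norm_inner_le_norm _ _
  rw [integral_integral_swap hprod]
  simp_rw [integral_abs_inner_stdGaussian]
  rw [integral_const_mul]

/-- Averaging `|⟪μ y, g⟫|` over a standard Gaussian vector `g` turns bounds on the integrals of the
real functions `⟪μ, g⟫` into a bound on the total variation of `μ`. -/
theorem setIntegral_norm_le [SigmaFinite ν] (hμm : Measurable μ) (hμ : Integrable μ ν)
    (hb : ∀ s, MeasurableSet s → ‖∫ y in s, μ y ∂ν‖ ≤ b) (hφ : ‖φ‖ ≤ 1)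
    (hpos : ∀ y, 0 ≤ inner ℝ (μ y) φ) (hone : ∫ y, inner ℝ (μ y) φ ∂ν = 1) {C : Set Y}
    (hC : MeasurableSet C) :
    ∫ y in C, ‖μ y‖ ∂ν ≤ (∫ y in C, inner ℝ (μ y) φ ∂ν) * b
      + √(2 * Real.pi * (Module.finrank ℝ E - 1) *
          (b ^ 2 - 1 + ∫ y in C, inner ℝ (μ y) φ ∂ν)) := by
  set p := ∫ y in C, inner ℝ (μ y) φ ∂ν
  set e := ‖φ‖⁻¹ • φ
  have he : ‖e‖ = 1 := norm_smul_inv_norm (𝕜 := ℝ) fun h => by simp [h] at hone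
  have hg := (IsGaussian.memLp_id (stdGaussian E) 1 (by simp)).integrable le_rfl
  have hinner : Integrable (fun g => |inner ℝ e g|) (stdGaussian E) := (hg.const_inner e).abs
  have horth : Integrable (fun g => ‖g - inner ℝ e g • e‖) (stdGaussian E) :=
    (hg.sub ((hg.const_inner e).smul_const e)).norm
  have hgauss : √(2 / Real.pi) * ∫ y in C, ‖μ y‖ ∂ν ≤ √(2 / Real.pi) * (p * b)
      + √(Module.finrank ℝ E - 1 : ℝ) * (2 * √(b ^ 2 - 1 + p)) := by
    rw [← integral_integral_abs_inner_stdGaussian hμ.integrableOn]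
    calc _ ≤ ∫ g, (|inner ℝ e g| * (p * b) + ‖g - inner ℝ e g • e‖ * (2 * √(b ^ 2 - 1 + p)))
          ∂(stdGaussian E) :=
          integral_mono_of_nonneg (ae_of_all _ fun g => integral_nonneg fun y => abs_nonneg _)
            ((hinner.mul_const _).add (horth.mul_const _))
            (ae_of_all _ (setIntegral_abs_inner_le hμm hμ hb hφ hpos hone hC))
      _ = √(2 / Real.pi) * (p * b)
            + (∫ g, ‖g - inner ℝ e g • e‖ ∂(stdGaussian E)) * (2 * √(b ^ 2 - 1 + p)) := by
          rw [integral_add (hinner.mul_const _) (horth.mul_const _), integral_mul_const,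
            integral_mul_const, integral_abs_inner_stdGaussian, he, mul_one]
      _ ≤ _ := by
          gcongr
          exact integral_norm_sub_inner_smul_stdGaussian_le he
  have := Real.pi_pos
  have hsqrt : √(2 / Real.pi) * √(2 * Real.pi * (Module.finrank ℝ E - 1) * (b ^ 2 - 1 + p))
      = √(Module.finrank ℝ E - 1 : ℝ) * (2 * √(b ^ 2 - 1 + p)) := by
    have : Nontrivial E := ⟨e, 0, fun h => by simp [h] at he⟩
    have hdim : (1 : ℝ) ≤ Module.finrank ℝ E := mod_cast Module.finrank_pos
    rw [← Real.sqrt_mul (by positivity), mul_left_comm _ (2 : ℝ),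
      ← Real.sqrt_mul (sub_nonneg.2 hdim),
      show 2 / Real.pi * (2 * Real.pi * (Module.finrank ℝ E - 1) * (b ^ 2 - 1 + p))
        = 2 ^ 2 * ((Module.finrank ℝ E - 1) * (b ^ 2 - 1 + p)) by field_simp,
      Real.sqrt_mul (by norm_num), Real.sqrt_sq (by norm_num)]
  refine le_of_mul_le_mul_left ?_ (by positivity : 0 < √(2 / Real.pi))
  rwa [mul_add, hsqrt]

theorem two_pi_mul_sub_one_sq_le_pow_three {x : ℝ} (hx : 1 ≤ x) :
    2 * Real.pi * (x - 1) ^ 2 ≤ x ^ 3 := by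
  have := Real.pi_lt_d2
  nlinarith [mul_nonneg (sq_nonneg (2 * x - 6)) (by linarith : 0 ≤ x), sq_nonneg (x - 1),
    mul_nonneg (sq_nonneg (x - 3)) (by linarith : 0 ≤ 4 * x - 3)]

theorem sqrt_two_pi_mul_le {m p : ℝ} (hm : 0 ≤ m) (hp : 0 ≤ p) :
    √(2 * Real.pi * m * (m + p)) ≤ √(2 * Real.pi) * (m + p / 2) := by
  refine Real.sqrt_le_iff.2 ⟨by positivity, ?_⟩
  rw [mul_pow, Real.sq_sqrt (by positivity), mul_assoc]
  gcongr
  nlinarith [sq_nonneg p]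

theorem mul_sqrt_add_sqrt_two_pi_mul_le {n : ℕ} {p : ℝ} (hn : 1 ≤ n) (hp : 0 ≤ p) :
    p * √n + √(2 * Real.pi * (n - 1) * (n - 1 + p)) ≤ n * √n * (1 + p) := by
  rcases hn.eq_or_lt with rfl | hn
  · simp
  have hn' : (2 : ℝ) ≤ n := mod_cast hn
  have hπ : √(2 * Real.pi) ≤ 2 * √n := by
    refine Real.sqrt_le_iff.2 ⟨by positivity, ?_⟩
    rw [mul_pow, Real.sq_sqrt (by positivity)]
    linarith [Real.pi_le_four]
  have hconst : √(2 * Real.pi) * (n - 1) ≤ n * √n := by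
    refine abs_le_of_sq_le_sq' ?_ (by positivity) |>.2
    rw [mul_pow, mul_pow, Real.sq_sqrt (by positivity), Real.sq_sqrt (by positivity)]
    linarith [two_pi_mul_sub_one_sq_le_pow_three (x := n) (by linarith)]
  have hslope : √n + √(2 * Real.pi) / 2 ≤ n * √n := by
    nlinarith [Real.sqrt_nonneg n]
  have hroot := sqrt_two_pi_mul_le (m := n - 1) (by linarith) hp
  nlinarith

theorem setIntegral_norm_le_of_sqrt_finrank [SigmaFinite ν] (hμm : Measurable μ)
    (hμ : Integrable μ ν)
    (hb : ∀ s, MeasurableSet s → ‖∫ y in s, μ y ∂ν‖ ≤ √(Module.finrank ℝ E)) (hφ : ‖φ‖ ≤ 1)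
    (hpos : ∀ y, 0 ≤ inner ℝ (μ y) φ) (hone : ∫ y, inner ℝ (μ y) φ ∂ν = 1) {C : Set Y}
    (hC : MeasurableSet C) :
    ∫ y in C, ‖μ y‖ ∂ν ≤ Module.finrank ℝ E * √(Module.finrank ℝ E)
      * (1 + ∫ y in C, inner ℝ (μ y) φ ∂ν) := by
  have : Nontrivial E := ⟨φ, 0, fun h => by simp [h] at hone⟩
  have hnorm := setIntegral_norm_le hμm hμ hb hφ hpos hone hC
  rw [Real.sq_sqrt (by positivity)] at hnorm
  exact hnorm.trans (mul_sqrt_add_sqrt_two_pi_mul_le Module.finrank_pos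
    (integral_nonneg_of_ae (ae_of_all _ hpos)))

end VariationBound

section Bind

variable {Y Z : Type*} [MeasurableSpace Y] [MeasurableSpace Z]

theorem snd_compProd_apply {Θ : Type*} [MeasurableSpace Θ] (κ : Kernel Θ Y) [IsSFiniteKernel κ]
    (η : Kernel (Θ × Y) Z) [IsSFiniteKernel η] (θ : Θ) :
    (κ ⊗ₖ η).snd θ = (κ θ).bind fun y => η (θ, y) := by
  rw [Kernel.snd_apply, Kernel.compProd_apply_eq_compProd_sectR]
  exact Measure.snd_compProd _ _

theorem bind_bind_map_eq_map_compProd {m : Measure Y} [SFinite m] (κ : Kernel Y Z)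
    [IsMarkovKernel κ] (K : Kernel (Y × Z) ℝ) [IsMarkovKernel K] :
    (m.bind fun x => (κ x).bind fun a => (K (x, a)).map fun R => (x, a, R)) =
      ((m ⊗ₘ κ) ⊗ₘ K).map fun p => (p.1.1, p.1.2, p.2) := by
  have hassoc : Measurable fun p : (Y × Z) × ℝ => (p.1.1, p.1.2, p.2) := by fun_prop
  have hinner : Measurable fun p : Y × Z => (K p).map fun R => (p.1, p.2, R) :=
    measurable_map_param (f := fun p R => (p.1, p.2, R)) K.measurable (by fun_prop)
  have houter : Measurable fun x : Y => (κ x).bind fun a => (K (x, a)).map fun R => (x, a, R) :=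
    measurable_bind_param (f := fun x a => (K (x, a)).map fun R => (x, a, R)) κ.measurable hinner
  ext s hs
  rw [Measure.bind_apply hs houter.aemeasurable, Measure.map_apply hassoc hs,
    Measure.compProd_apply (hs.preimage hassoc),
    Measure.lintegral_compProd (Kernel.measurable_kernel_prodMk_left (hs.preimage hassoc))]
  refine lintegral_congr fun x => ?_
  have hsection : Measurable fun a => (K (x, a)).map fun R => (x, a, R) :=
    hinner.comp measurable_prodMk_left
  rw [Measure.bind_apply hs hsection.aemeasurable]
  refine lintegral_congr fun a => ?_
  exact Measure.map_apply (by fun_prop) hs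

theorem integral_comp_measure {E : Type*} [NormedAddCommGroup E] [NormedSpace ℝ E]
    {m : Measure Y} {κ : Kernel Y Z} {f : Z → E} (hf : Integrable f (κ ∘ₘ m)) :
    ∫ z, f z ∂(κ ∘ₘ m) = ∫ y, ∫ z, f z ∂κ y ∂m := by
  rw [Measure.comp_eq_comp_const_apply] at hf ⊢
  exact Kernel.integral_comp hf

end Bind

section Net

variable {S A : Type*} {G : Set (S → A → ℝ)} {ε : ℝ}

theorem exists_cover_of_coveringNumber_ne_top (hG : coveringNumber G ε ≠ ⊤) :
    ∃ c : Fin (coveringNumber G ε).toNat → S → A → ℝ,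
      ∀ g ∈ G, ∃ i, ∀ x a, |g x a - c i x a| ≤ ε := by
  let HasCover (N : ℕ) : Prop :=
    ∃ c : Fin N → S → A → ℝ, ∀ g ∈ G, ∃ i, ∀ x a, |g x a - c i x a| ≤ ε
  have hinf : coveringNumber G ε = ⨅ N : {N // HasCover N}, ((N : ℕ) : ℕ∞) := iInf_subtype'
  have : Nonempty {N // HasCover N} := by
    by_contra hempty
    rw [not_nonempty_iff] at hempty
    exact hG (hinf.trans (iInf_of_empty _))
  obtain ⟨⟨N, hcover⟩, hN⟩ := ciInf_mem fun N : {N // HasCover N} => ((N : ℕ) : ℕ∞)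
  rwa [hinf, ← hN, ENat.toNat_natCast]

theorem exists_net_of_coveringNumber_ne_top (hG : coveringNumber G ε ≠ ⊤) (hne : G.Nonempty) :
    ∃ c : Fin (coveringNumber G ε).toNat → S → A → ℝ, (∀ i, c i ∈ G) ∧
      ∀ g ∈ G, ∃ i, ∀ x a, |g x a - c i x a| ≤ 2 * ε := by
  obtain ⟨c, hc⟩ := exists_cover_of_coveringNumber_ne_top hG
  have hproj (i : Fin (coveringNumber G ε).toNat) : ∃ g' ∈ G,
      (∃ g ∈ G, ∀ x a, |g x a - c i x a| ≤ ε) → ∀ x a, |g' x a - c i x a| ≤ ε := by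
    by_cases hi : ∃ g ∈ G, ∀ x a, |g x a - c i x a| ≤ ε
    · obtain ⟨g, hg, hgc⟩ := hi
      exact ⟨g, hg, fun _ => hgc⟩
    · exact ⟨hne.some, hne.some_mem, fun h => absurd h hi⟩
  choose c' hc'G hc' using hproj
  refine ⟨c', hc'G, fun g hg => ?_⟩
  obtain ⟨i, hi⟩ := hc g hg
  refine ⟨i, fun x a => (abs_sub_le _ (c i x a) _).trans ?_⟩
  linarith [hi x a, hc' i ⟨g, hg, hi⟩ x a, abs_sub_comm (c i x a) (c' i x a)]

theorem one_le_toNat_coveringNumber (hG : coveringNumber G ε ≠ ⊤) (hne : G.Nonempty) :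
    1 ≤ (coveringNumber G ε).toNat := by
  obtain ⟨c, hc⟩ := exists_cover_of_coveringNumber_ne_top hG
  obtain ⟨i, -⟩ := hc _ hne.some_mem
  exact i.pos

end Net

section Greedy

variable {Y A : Type*} [MeasurableSpace Y] [MeasurableSpace A]

theorem integrable_sqrt {m : Measure Y} [IsFiniteMeasure m] {E : Y → ℝ} (hE0 : ∀ y, 0 ≤ E y)
    (hE : Integrable E m) : Integrable (fun y => √(E y)) m := by
  refine (hE.add (integrable_const 1)).mono' hE.1.aemeasurable.sqrt.aestronglyMeasurable
    (ae_of_all _ fun y => ?_)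
  rw [Real.norm_of_nonneg (Real.sqrt_nonneg _), Real.sqrt_le_iff, Pi.add_apply]
  constructor <;> nlinarith [hE0 y]

theorem setIntegral_sqrt_le {m m' : Measure Y} [IsProbabilityMeasure m]
    {S : Set Y} {c : ℝ} {E : Y → ℝ} (hS : MeasurableSet S) (hc : 0 ≤ c)
    (hdom : m.restrict S ≤ ENNReal.ofReal c • m') (hE0 : ∀ y, 0 ≤ E y) (hE : Integrable E m)
    (hE' : Integrable E m') :
    ∫ y in S, √(E y) ∂m ≤ √(c * ∫ y, E y ∂m') := by
  have hsqrt : (fun y => S.indicator (fun y => √(E y)) y) = fun y => √(S.indicator E y) := by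
    ext y
    by_cases hy : y ∈ S <;> simp [hy]
  have hind : Integrable (S.indicator E) m := hE.indicator hS
  have hind0 (y : Y) : 0 ≤ S.indicator E y := Set.indicator_nonneg (fun y _ => hE0 y) y
  calc ∫ y in S, √(E y) ∂m = ∫ y, √(S.indicator E y) ∂m := by
        rw [← integral_indicator hS, hsqrt]
    _ ≤ √(∫ y, S.indicator E y ∂m) :=
        Real.strictConcaveOn_sqrt.concaveOn.le_map_integral Real.continuous_sqrt.continuousOn
          isClosed_Ici (ae_of_all _ hind0) hind (integrable_sqrt hind0 hind)
    _ ≤ √(c * ∫ y, E y ∂m') := by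
        refine Real.sqrt_le_sqrt ?_
        rw [integral_indicator hS, ← ENNReal.toReal_ofReal hc, ← smul_eq_mul,
          ← integral_smul_measure]
        exact integral_mono_measure hdom (ae_of_all _ hE0) (hE'.smul_measure ENNReal.ofReal_ne_top)

variable [Fintype A]

theorem integral_sub_le_of_greedy {p : Measure A} [IsProbabilityMeasure p] {g q : A → ℝ} {a₀ : A}
    (hg : ∀ a, g a ≤ g a₀) (hq : Integrable q p) :
    ∫ a, q a ∂p - q a₀ ≤ 2 * √(∑ a, (g a - q a) ^ 2) := by
  have herr (a : A) : |g a - q a| ≤ √(∑ a, (g a - q a) ^ 2) :=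
    Real.abs_le_sqrt (Finset.single_le_sum (f := fun a => (g a - q a) ^ 2)
      (fun a _ => sq_nonneg _) (Finset.mem_univ a))
  have hgap (a : A) : q a ≤ q a₀ + 2 * √(∑ a, (g a - q a) ^ 2) := by
    linarith [hg a, (abs_le.1 (herr a)).1, (abs_le.1 (herr a₀)).2]
  have hmean := integral_mono hq (integrable_const _) hgap
  rw [integral_const, probReal_univ, one_smul] at hmean
  linarith

theorem integral_sum_eq_card_mul_integral_prod_uniform [Nonempty A] [MeasurableSingletonClass A]
    {m : Measure Y} [SFinite m] {F : Y × A → ℝ}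
    (hF : Integrable F (m.prod (PMF.uniformOfFintype A).toMeasure)) :
    ∫ y, ∑ a, F (y, a) ∂m =
      Fintype.card A * ∫ p, F p ∂(m.prod (PMF.uniformOfFintype A).toMeasure) := by
  rw [integral_prod _ hF, ← integral_const_mul]
  refine integral_congr_ae (ae_of_all _ fun y => ?_)
  simp [PMF.integral_eq_sum, ← Finset.mul_sum]

end Greedy

section Complexity

variable {Y : ℕ → Type*} {A : Type*} {G : ∀ t, Set (Y t → A → ℝ)} {h n : ℕ} {δ : ℝ}

/-- The complexity term `max_{t ∈ [h]} ln 𝒩_{G_t}(1 / n) + ln (n / δ)` of the regret bound. -/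
noncomputable def complexity (G : ∀ t, Set (Y t → A → ℝ)) (h n : ℕ) (δ : ℝ) : ℝ :=
  (⨆ t : Fin h, Real.log (coveringNumber (G t) (1 / n)).toNat) + Real.log (n / δ)

theorem log_coveringNumber_add_le_complexity (t : Fin h) :
    Real.log (coveringNumber (G t) (1 / n)).toNat + Real.log (n / δ) ≤ complexity G h n δ :=
  add_le_add_left (le_ciSup (f := fun t : Fin h => Real.log (coveringNumber (G t) (1 / n)).toNat)
    (Set.finite_range _).bddAbove t) _

theorem log_two_le_complexity (hδ : 0 < δ) (hnδ : 2 * δ ≤ n) :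
    Real.log 2 ≤ complexity G h n δ :=
  (Real.log_le_log two_pos ((le_div_iff₀ hδ).2 hnδ)).trans
    (le_add_of_nonneg_left (Real.iSup_nonneg fun _ => Real.log_natCast_nonneg _))

end Complexity

variable {X : ℕ → Type*} [∀ t, MeasurableSpace (X t)] {A : Type*} [MeasurableSpace A] {d H : ℕ}

instance (π : Policy X A) (t : ℕ) : IsMarkovKernel (π.ker t) := π.markov t

instance (P : PolicyDist X A) : IsProbabilityMeasure P.law := P.prob

namespace MDP

section Parametric

variable {Θ : Type*} [MeasurableSpace Θ] (M : MDP X A d H) {pol : Θ → Policy X A}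

theorem measurable_stateLaw_param {t : ℕ} (ht : t < H)
    (hpol : ∀ ℓ, ℓ < t → Measurable fun p : Θ × X ℓ => (pol p.1).ker ℓ p.2) :
    Measurable fun θ => M.stateLaw (pol θ) t := by
  induction t with
  | zero => exact measurable_const
  | succ t ih =>
    have := fun θ => M.isProbabilityMeasure_stateLaw (pol θ) t (by omega)
    refine measurable_bind_param (ih (by omega) fun ℓ hℓ => hpol ℓ (by omega)) ?_
    exact measurable_bind_param (f := fun p a => M.T t (p.2, a)) (hpol t (by omega))
      ((M.T t).measurable.comp (by fun_prop))

theorem exists_kernel_eq_returnLaw {r : ∀ t, X t → A → ℝ} {h : ℕ} (hH : h ≤ H)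
    (hr : ∀ t, t < h → Measurable fun p : X t × A => r t p.1 p.2) (k : ℕ) :
    ∀ t, t + k < h → (∀ ℓ, t < ℓ → ℓ < h → Measurable fun p : Θ × X ℓ => (pol p.1).ker ℓ p.2) →
      ∃ K : Kernel (Θ × X t × A) ℝ, IsMarkovKernel K ∧
        ∀ θ x a, K (θ, x, a) = M.returnLaw (pol θ) r k t x a := by
  induction k with
  | zero =>
    intro t ht _
    exact ⟨.deterministic (fun p => r t p.2.1 p.2.2) ((hr t ht).comp measurable_snd), inferInstance,
      fun θ x a => Kernel.deterministic_apply ..⟩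
  | succ k ih =>
    intro t ht hpol
    obtain ⟨K, _, hK⟩ := ih (t + 1) (by omega) fun ℓ h1 h2 => hpol ℓ (by omega) h2
    have := M.markov_T t (by omega)
    let actionLaw : Kernel (Θ × X (t + 1)) A := ⟨_, hpol (t + 1) (by omega) (by omega)⟩
    have : IsMarkovKernel actionLaw := ⟨fun p => ((pol p.1).markov (t + 1)).1 p.2⟩
    let stateReturn : Kernel (Θ × X (t + 1)) ℝ :=
      (actionLaw ⊗ₖ K.comap (fun q => (q.1.1, q.1.2, q.2)) (by fun_prop)).snd
    let laterReturn : Kernel (Θ × X t × A) ℝ := ((M.T t).comap Prod.snd measurable_snd ⊗ₖ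
      stateReturn.comap (fun q => (q.1.1, q.2)) (by fun_prop)).snd
    have hlater (θ : Θ) (x : X t) (a : A) : laterReturn (θ, x, a) = (M.T t (x, a)).bind fun y =>
        ((pol θ).ker (t + 1) y).bind fun b => M.returnLaw (pol θ) r k (t + 1) y b := by
      simp only [laterReturn, stateReturn, snd_compProd_apply, Kernel.comap_apply, hK]
      rfl
    have hadd : Measurable fun p : (Θ × X t × A) × ℝ => r t p.1.2.1 p.1.2.2 + p.2 :=
      (((hr t (by omega)).comp measurable_snd).comp measurable_fst).add measurable_snd
    refine ⟨⟨fun p => (laterReturn p).map fun R => r t p.2.1 p.2.2 + R,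
      measurable_map_param (f := fun p R => r t p.2.1 p.2.2 + R) laterReturn.measurable hadd⟩,
      ⟨fun p => Measure.isProbabilityMeasure_map (by fun_prop)⟩, fun θ x a => ?_⟩
    exact congrArg (Measure.map _) (hlater θ x a)

end Parametric

section Return

variable (M : MDP X A d H) {r : ∀ t, X t → A → ℝ} {h : ℕ} (hH : h ≤ H)
  (hr : ∀ t, t < h → Measurable fun p : X t × A => r t p.1 p.2)

include hH hr

theorem exists_kernel_eq_returnLaw_of_policy (π : Policy X A) {k t : ℕ} (hk : t + k < h) :
    ∃ K : Kernel (X t × A) ℝ, IsMarkovKernel K ∧ ∀ x a, K (x, a) = M.returnLaw π r k t x a := by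
  obtain ⟨K, _, hK⟩ := M.exists_kernel_eq_returnLaw (pol := fun _ : Unit => π) hH hr k t hk
    fun ℓ _ _ => (π.ker ℓ).measurable.comp measurable_snd
  exact ⟨K.comap (fun p => ((), p)) (by fun_prop), inferInstance, hK ()⟩

theorem measurable_returnLaw (π : Policy X A) {k t : ℕ} (hk : t + k < h) :
    Measurable fun p : X t × A => M.returnLaw π r k t p.1 p.2 := by
  obtain ⟨K, _, hK⟩ := M.exists_kernel_eq_returnLaw_of_policy hH hr π hk
  exact (funext fun p => hK p.1 p.2 : ⇑K = _) ▸ K.measurable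

/-- The law of the total reward of the layers `t, …, t + k`, as a kernel. -/
noncomputable def returnKernel (π : Policy X A) {k t : ℕ} (hk : t + k < h) :
    Kernel (X t × A) ℝ where
  toFun p := M.returnLaw π r k t p.1 p.2
  measurable' := M.measurable_returnLaw hH hr π hk

instance (π : Policy X A) {k t : ℕ} (hk : t + k < h) :
    IsMarkovKernel (M.returnKernel hH hr π hk) := by
  obtain ⟨K, hKm, hK⟩ := M.exists_kernel_eq_returnLaw_of_policy hH hr π hk
  convert hKm
  ext1 p
  exact (hK p.1 p.2).symm

theorem ae_abs_returnLaw_le {b : ℕ → ℝ} (hb : ∀ t, t < h → ∀ x a, |r t x a| ≤ b t)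
    (π : Policy X A) (k : ℕ) : ∀ t, t + k < h → ∀ x a,
      ∀ᵐ R ∂(M.returnLaw π r k t x a), |R| ≤ ∑ ℓ ∈ Finset.Ico t (t + k + 1), b ℓ := by
  have hmeas (C : ℝ) : MeasurableSet {R : ℝ | |R| ≤ C} :=
    measurableSet_le (by fun_prop) measurable_const
  induction k with
  | zero =>
    intro t ht x a
    rw [returnLaw, ae_dirac_iff (hmeas _)]
    simpa using hb t ht x a
  | succ k ih =>
    intro t ht x a
    have hlater (y : X (t + 1)) : ∀ᵐ R ∂((M.returnKernel hH hr π (by omega : t + 1 + k < h)).sectR y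
        ∘ₘ π.ker (t + 1) y), |R| ≤ ∑ ℓ ∈ Finset.Ico (t + 1) (t + 1 + k + 1), b ℓ :=
      Measure.ae_comp_of_ae_ae (hmeas _) (ae_of_all _ fun a' => ih (t + 1) (by omega) y a')
    have hstate := measurable_bind_param (π.ker (t + 1)).measurable
      (M.returnKernel hH hr π (by omega : t + 1 + k < h)).measurable
    rw [returnLaw, ae_map_iff (by fun_prop) (hmeas _)]
    filter_upwards [Measure.ae_comp_of_ae_ae (κ := ⟨_, hstate⟩) (hmeas _)
      (ae_of_all (M.T t (x, a)) hlater)] with R hR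
    rw [Finset.sum_eq_sum_Ico_succ_bot (by omega : t < t + (k + 1) + 1)]
    refine (abs_add_le _ _).trans (add_le_add (hb t (by omega) x a) ?_)
    rwa [show t + (k + 1) + 1 = t + 1 + k + 1 by omega]

end Return

/-- Whatever policy is played, the rewards of the layers `t, …, h - 1` almost surely add up to at
most `B` in absolute value, for all initial layers `t`, states and actions. -/
def ReturnsBoundedBy (M : MDP X A d H) (r : ∀ t, X t → A → ℝ) (h : ℕ) (B : ℝ) : Prop :=
  ∀ t, t < h → ∀ (π : Policy X A) (x : X t) (a : A),
    ∀ᵐ R ∂(M.returnLaw π r (h - 1 - t) t x a), |R| ≤ B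

/-- The value function of `π`. -/
noncomputable def stateValue (M : MDP X A d H) (π : Policy X A) (r : ∀ t, X t → A → ℝ) (h t : ℕ)
    (x : X t) : ℝ :=
  ∫ a, M.Q π r h t x a ∂(π.ker t x)

theorem Q_last (M : MDP X A d H) {r : ∀ t, X t → A → ℝ} {h : ℕ} (π : Policy X A) {t : ℕ}
    (ht : t + 1 = h) : M.Q π r h t = r t := by
  ext x a
  rw [Q, show h - 1 - t = 0 by omega, returnLaw, integral_dirac]

section Value

variable (M : MDP X A d H) {r : ∀ t, X t → A → ℝ} {h : ℕ} (hH : h ≤ H)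
  (hr : ∀ t, t < h → Measurable fun p : X t × A => r t p.1 p.2)

include hH hr

theorem returnsBoundedBy_sum {b : ℕ → ℝ} (hb : ∀ t, t < h → ∀ x a, |r t x a| ≤ b t)
    (hb0 : ∀ t, t < h → 0 ≤ b t) : M.ReturnsBoundedBy r h (∑ t ∈ Finset.range h, b t) := by
  intro t ht π x a
  filter_upwards [M.ae_abs_returnLaw_le hH hr hb π (h - 1 - t) t (by omega) x a] with R hR
  refine hR.trans (Finset.sum_le_sum_of_subset_of_nonneg (fun ℓ hℓ => ?_) fun ℓ hℓ _ =>
    hb0 ℓ (Finset.mem_range.1 hℓ))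
  have := Finset.mem_Ico.1 hℓ
  exact Finset.mem_range.2 (by omega)

theorem measurable_Q (π : Policy X A) {t : ℕ} (ht : t < h) :
    Measurable fun p : X t × A => M.Q π r h t p.1 p.2 :=
  measurable_kernel_mean (M.returnKernel hH hr π (by omega : t + (h - 1 - t) < h))

theorem measurable_integral_Q (π σ : Policy X A) {t : ℕ} (ht : t < h) :
    Measurable fun x : X t => ∫ a, M.Q σ r h t x a ∂(π.ker t x) :=
  ((M.measurable_Q hH hr σ ht).stronglyMeasurable.integral_kernel_prod_right'
    (κ := π.ker t)).measurable

variable {B : ℝ} (hB : M.ReturnsBoundedBy r h B)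

include hB

theorem abs_Q_le (π : Policy X A) {t : ℕ} (ht : t < h) (x : X t) (a : A) :
    |M.Q π r h t x a| ≤ B := by
  have : IsProbabilityMeasure (M.returnLaw π r (h - 1 - t) t x a) :=
    inferInstanceAs (IsProbabilityMeasure
      (M.returnKernel hH hr π (by omega : t + (h - 1 - t) < h) (x, a)))
  exact abs_integral_le_of_ae (hB t ht π x a)

theorem abs_integral_Q_le (π σ : Policy X A) {t : ℕ} (ht : t < h) (x : X t) :
    |∫ a, M.Q σ r h t x a ∂(π.ker t x)| ≤ B :=
  abs_integral_le_of_ae (ae_of_all _ fun a => M.abs_Q_le hH hr hB σ ht x a)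

theorem integrable_integral_Q (π σ : Policy X A) {t : ℕ} (ht : t < h) (m : Measure (X t))
    [IsFiniteMeasure m] : Integrable (fun x : X t => ∫ a, M.Q σ r h t x a ∂(π.ker t x)) m :=
  .of_bound (M.measurable_integral_Q hH hr π σ ht).aestronglyMeasurable B
    (ae_of_all _ fun x => M.abs_integral_Q_le hH hr hB π σ ht x)

theorem integrable_Q (σ : Policy X A) {t : ℕ} (ht : t < h) (m : Measure (X t × A))
    [IsFiniteMeasure m] : Integrable (fun p => M.Q σ r h t p.1 p.2) m :=
  .of_bound (M.measurable_Q hH hr σ ht).aestronglyMeasurable B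
    (ae_of_all _ fun p => M.abs_Q_le hH hr hB σ ht p.1 p.2)

theorem Q_eq_add_integral_stateValue (π : Policy X A) {t : ℕ} (ht : t + 1 < h) (x : X t) (a : A) :
    M.Q π r h t x a = r t x a + ∫ y, M.stateValue π r h (t + 1) y ∂(M.T t (x, a)) := by
  have := M.markov_T t (by omega)
  have hret := hB t (by omega) π x a
  obtain ⟨k, hk⟩ : ∃ k, h - 1 - t = k + 1 := ⟨h - 1 - t - 1, by omega⟩
  let K := M.returnKernel hH hr π (by omega : t + 1 + k < h)
  let stateReturn : Kernel (X (t + 1)) ℝ :=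
    ⟨_, measurable_bind_param (π.ker (t + 1)).measurable K.measurable⟩
  have hstate (y : X (t + 1)) : stateReturn y = K.sectR y ∘ₘ π.ker (t + 1) y := rfl
  have : IsMarkovKernel stateReturn := ⟨fun y => by rw [hstate]; infer_instance⟩
  rw [hk] at hret
  have hbound : ∀ᵐ R ∂(stateReturn ∘ₘ M.T t (x, a)), ‖r t x a + R‖ ≤ B :=
    ae_of_ae_map (by fun_prop) hret
  have hint : Integrable (fun R : ℝ => R) (stateReturn ∘ₘ M.T t (x, a)) := by
    refine ((Integrable.of_bound (by fun_prop) B hbound).sub (integrable_const (r t x a))).congr ?_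
    exact ae_of_all _ fun R => add_sub_cancel_left _ R
  have hmean : ∫ R, R ∂(stateReturn ∘ₘ M.T t (x, a))
      = ∫ y, M.stateValue π r h (t + 1) y ∂(M.T t (x, a)) := by
    rw [integral_comp_measure hint]
    refine integral_congr_ae ?_
    filter_upwards [Measure.ae_integrable_of_integrable_comp hint] with y hy
    rw [hstate] at hy ⊢
    rw [integral_comp_measure hy]
    simp only [stateValue, Q, show h - 1 - (t + 1) = k by omega]
    rfl
  rw [Q, hk, ← hmean]
  refine (integral_map (by fun_prop) (by fun_prop)).trans ?_
  exact (integral_add (integrable_const (r t x a)) hint).trans (by simp)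

end Value

theorem stateLaw_congr (M : MDP X A d H) {π π' : Policy X A} {t : ℕ}
    (hπ : ∀ ℓ, ℓ < t → π.ker ℓ = π'.ker ℓ) : M.stateLaw π t = M.stateLaw π' t := by
  induction t with
  | zero => rfl
  | succ t ih => rw [stateLaw, stateLaw, ih fun ℓ hℓ => hπ ℓ (by omega), hπ t (by omega)]

theorem returnLaw_congr (M : MDP X A d H) {π π' : Policy X A} (r : ∀ t, X t → A → ℝ) (k : ℕ) :
    ∀ t, (∀ ℓ, t < ℓ → π.ker ℓ = π'.ker ℓ) → ∀ x a,
      M.returnLaw π r k t x a = M.returnLaw π' r k t x a := by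
  induction k with
  | zero => intros; rfl
  | succ k ih =>
    intro t hπ x a
    simp only [returnLaw, hπ (t + 1) (by omega), ih (t + 1) fun ℓ hℓ => hπ ℓ (by omega)]

/-- The advantage in layer `t` of `π` over `σ`: the expected gain, from the state `x`, of drawing
one action from `π` before following `σ`. -/
noncomputable def advantage (M : MDP X A d H) (π σ : Policy X A) (r : ∀ t, X t → A → ℝ) (h t : ℕ)
    (x : X t) : ℝ :=
  ∫ a, M.Q σ r h t x a ∂(π.ker t x) - M.stateValue σ r h t x

section PerformanceDifference

variable (M : MDP X A d H) {r : ∀ t, X t → A → ℝ} {h : ℕ} (hH : h ≤ H)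
  (hr : ∀ t, t < h → Measurable fun p : X t × A => r t p.1 p.2)

include hH hr

theorem obsLaw_eq_map_compProd (π : Policy X A) {t : ℕ} (ht : t < h) :
    M.obsLaw π r h t = ((M.stateLaw π t ⊗ₘ π.ker t) ⊗ₘ
      M.returnKernel hH hr π (by omega : t + (h - 1 - t) < h)).map
        fun p => (p.1.1, p.1.2, p.2) := by
  have := M.isProbabilityMeasure_stateLaw π t (by omega)
  rw [obsLaw]
  exact bind_bind_map_eq_map_compProd (π.ker t)
    (M.returnKernel hH hr π (by omega : t + (h - 1 - t) < h))

variable {B : ℝ} (hB : M.ReturnsBoundedBy r h B)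

include hB

theorem value_eq_integral_stateValue (π : Policy X A) (h1 : 1 ≤ h) :
    M.value π r h = ∫ x, M.stateValue π r h 0 x ∂(M.stateLaw π 0) := by
  have := M.isProbabilityMeasure_stateLaw π 0 (by omega)
  let K := M.returnKernel hH hr π (by omega : 0 + (h - 1 - 0) < h)
  have hbound : ∀ᵐ p ∂((M.stateLaw π 0 ⊗ₘ π.ker 0) ⊗ₘ K), |p.2| ≤ B :=
    ae_abs_snd_le fun p => hB 0 (by omega) π p.1 p.2
  rw [value, M.obsLaw_eq_map_compProd hH hr π (by omega),
    integral_map (by fun_prop) measurable_snd.snd.aestronglyMeasurable,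
    Measure.integral_compProd (.of_bound (by fun_prop) B hbound)]
  exact Measure.integral_compProd (M.integrable_Q hH hr hB π (by omega) _)

theorem abs_value_le (π : Policy X A) (h1 : 1 ≤ h) : |M.value π r h| ≤ B := by
  have := M.isProbabilityMeasure_stateLaw π 0 (by omega)
  rw [M.value_eq_integral_stateValue hH hr hB π h1]
  exact abs_integral_le_of_ae
    (ae_of_all _ fun x => M.abs_integral_Q_le hH hr hB π π (by omega) x)

theorem integral_stateValue_sub_succ (π σ : Policy X A) {t : ℕ} (ht : t + 1 < h) :
    ∫ y, (M.stateValue π r h (t + 1) y - M.stateValue σ r h (t + 1) y) ∂(M.stateLaw π (t + 1)) =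
      ∫ x, (M.stateValue π r h t x - ∫ a, M.Q σ r h t x a ∂(π.ker t x)) ∂(M.stateLaw π t) := by
  have := M.isProbabilityMeasure_stateLaw π t (by omega)
  have := M.isProbabilityMeasure_stateLaw π (t + 1) (by omega)
  have := M.markov_T t (by omega)
  have hV (τ : Policy X A) (m : Measure (X (t + 1))) [IsFiniteMeasure m] :
      Integrable (M.stateValue τ r h (t + 1)) m :=
    M.integrable_integral_Q hH hr hB τ τ ht m
  have hgap (p : X t × A) :
      ∫ y, (M.stateValue π r h (t + 1) y - M.stateValue σ r h (t + 1) y) ∂(M.T t p) =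
        M.Q π r h t p.1 p.2 - M.Q σ r h t p.1 p.2 := by
    rw [M.Q_eq_add_integral_stateValue hH hr hB π ht, M.Q_eq_add_integral_stateValue hH hr hB σ ht,
      integral_sub (hV π _) (hV σ _)]
    ring
  have hlaw := M.stateLaw_succ π t (by omega)
  have hint := (hV π (M.stateLaw π (t + 1))).sub (hV σ _)
  have hQ (τ : Policy X A) := M.integrable_Q hH hr hB τ (by omega : t < h)
    (M.stateLaw π t ⊗ₘ π.ker t)
  rw [hlaw] at hint ⊢
  refine (integral_comp_measure hint).trans ?_
  simp only [Pi.sub_apply, hgap]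
  rw [integral_sub (hQ π) (hQ σ), Measure.integral_compProd (hQ π),
    Measure.integral_compProd (hQ σ)]
  exact (integral_sub (M.integrable_integral_Q hH hr hB π π (by omega) _)
    (M.integrable_integral_Q hH hr hB π σ (by omega) _)).symm

theorem integral_advantage_eq_sub (π σ : Policy X A) {t : ℕ} (ht : t + 1 < h) :
    ∫ x, M.advantage π σ r h t x ∂(M.stateLaw π t) =
      ∫ x, (M.stateValue π r h t x - M.stateValue σ r h t x) ∂(M.stateLaw π t) -
        ∫ y, (M.stateValue π r h (t + 1) y - M.stateValue σ r h (t + 1) y)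
          ∂(M.stateLaw π (t + 1)) := by
  have := M.isProbabilityMeasure_stateLaw π t (by omega)
  have hi (τ τ' : Policy X A) :=
    M.integrable_integral_Q hH hr hB τ τ' (by omega : t < h) (M.stateLaw π t)
  rw [M.integral_stateValue_sub_succ hH hr hB π σ ht]
  simp only [advantage, stateValue]
  rw [integral_sub (hi π σ) (hi σ σ), integral_sub (hi π π) (hi σ σ),
    integral_sub (hi π π) (hi π σ)]
  ring

theorem value_sub_value_eq_sum_integral_advantage (π σ : Policy X A) (h1 : 1 ≤ h) :
    M.value π r h - M.value σ r h =
      ∑ t ∈ Finset.range h, ∫ x, M.advantage π σ r h t x ∂(M.stateLaw π t) := by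
  have := M.isProbabilityMeasure_stateLaw π 0 (by omega)
  obtain ⟨m, rfl⟩ : ∃ m, h = m + 1 := ⟨h - 1, by omega⟩
  have hlast : M.advantage π σ r (m + 1) m =
      fun x => M.stateValue π r (m + 1) m x - M.stateValue σ r (m + 1) m x := by
    ext x
    simp only [advantage, stateValue, M.Q_last _ rfl]
  rw [Finset.sum_range_succ, Finset.sum_congr rfl fun t ht => M.integral_advantage_eq_sub hH hr hB
      π σ (by have := Finset.mem_range.1 ht; omega : t + 1 < m + 1), Finset.sum_range_sub', hlast,
    sub_add_cancel, M.value_eq_integral_stateValue hH hr hB π h1,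
    M.value_eq_integral_stateValue hH hr hB σ h1]
  exact (integral_sub (M.integrable_integral_Q hH hr hB π π (by omega) _)
    (M.integrable_integral_Q hH hr hB σ σ (by omega) _)).symm

end PerformanceDifference

section Sample

/-- The law of the state `x_t` when a policy is first drawn from `P`. -/
noncomputable def mixLaw (M : MDP X A d H) (P : PolicyDist X A) (t : ℕ) : Measure (X t) :=
  P.law.bind fun θ => M.stateLaw (P.policy θ) t

variable (M : MDP X A d H) (P : PolicyDist X A)

theorem measurable_stateLaw_policy {t : ℕ} (ht : t < H) :
    Measurable fun θ => M.stateLaw (P.policy θ) t :=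
  M.measurable_stateLaw_param ht fun ℓ _ => (P.ker ℓ).measurable

theorem isProbabilityMeasure_mixLaw {t : ℕ} (ht : t < H) :
    IsProbabilityMeasure (M.mixLaw P t) := by
  have := fun θ => M.isProbabilityMeasure_stateLaw (P.policy θ) t ht
  exact isProbabilityMeasure_bind (M.measurable_stateLaw_policy P ht).aemeasurable
    (ae_of_all _ this)

theorem sampleLaw_eq_map_compProd [Fintype A] [Nonempty A] {r : ∀ t, X t → A → ℝ} {h : ℕ}
    (hH : h ≤ H) (π : Policy X A) {t : ℕ} (ht : t < h) {K : Kernel (X t × A) ℝ} [IsMarkovKernel K]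
    (hK : ∀ x a, K (x, a) = M.returnLaw π r (h - 1 - t) t x a) :
    M.sampleLaw P π r h t = (((M.mixLaw P t).prod (PMF.uniformOfFintype A).toMeasure) ⊗ₘ K).map
      fun p => (p.1.1, p.1.2, p.2) := by
  have := M.isProbabilityMeasure_mixLaw P (by omega : t < H)
  let explore (θ : P.Θ) := ((P.policy θ).splice t (unifPolicy X A)).splice (t + 1) π
  have hobs (θ : P.Θ) : M.obsLaw (explore θ) r h t = (M.stateLaw (P.policy θ) t).bind fun x =>
      (PMF.uniformOfFintype A).toMeasure.bind fun a => (K (x, a)).map fun R => (x, a, R) := by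
    have hbefore : M.stateLaw (explore θ) t = M.stateLaw (P.policy θ) t :=
      M.stateLaw_congr fun ℓ hℓ => by
        simp only [explore, Policy.splice, hℓ, Nat.lt_succ_of_lt hℓ, if_true]
    have hcurrent : (explore θ).ker t = Kernel.const _ (PMF.uniformOfFintype A).toMeasure := by
      simp [explore, Policy.splice, unifPolicy]
    have hafter (x : X t) (a : A) : M.returnLaw (explore θ) r (h - 1 - t) t x a = K (x, a) := by
      rw [hK]
      refine M.returnLaw_congr r _ t (fun ℓ hℓ => ?_) x a
      simp only [explore, Policy.splice, show ¬ ℓ < t + 1 by omega, if_false]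
    simp only [obsLaw, hbefore, hcurrent, hafter, Kernel.const_apply]
  have hactionReturn : Measurable fun x : X t => (PMF.uniformOfFintype A).toMeasure.bind
      fun a => (K (x, a)).map fun R => (x, a, R) :=
    measurable_bind_param measurable_const (measurable_map_param
      (f := fun (p : X t × A) R => (p.1, p.2, R)) K.measurable (by fun_prop))
  simp only [sampleLaw]
  rw [funext hobs, ← Measure.bind_bind (M.measurable_stateLaw_policy P (by omega)).aemeasurable
    hactionReturn.aemeasurable, ← mixLaw, ← Measure.compProd_const]
  exact bind_bind_map_eq_map_compProd (Kernel.const _ (PMF.uniformOfFintype A).toMeasure) K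

end Sample

section Occupancy

/-- The expected feature vector of `(x_t, a_t)` under `π`. -/
noncomputable def meanFeature (M : MDP X A d H) (π : Policy X A) (t : ℕ) :
    EuclideanSpace ℝ (Fin d) :=
  ∫ p, M.φ t p.1 p.2 ∂(M.stateLaw π t ⊗ₘ π.ker t)

variable (M : MDP X A d H)

theorem occ_succ_eq_inner (π : Policy X A) {t : ℕ} (ht : t < H) (x : X (t + 1)) :
    M.occ π (t + 1) x = inner ℝ (M.μ (t + 1) x) (M.meanFeature π t) := by
  have := M.isProbabilityMeasure_stateLaw π t ht
  have hint : Integrable (fun p : X t × A => M.φ t p.1 p.2) (M.stateLaw π t ⊗ₘ π.ker t) :=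
    .of_bound (M.measurable_φ t ht).aestronglyMeasurable 1
      (ae_of_all _ fun p => M.norm_φ_le t ht p.1 p.2)
  rw [occ, meanFeature, ← integral_inner hint,
    Measure.integral_compProd (hint.const_inner (𝕜 := ℝ) (M.μ (t + 1) x))]

theorem norm_meanFeature_le (π : Policy X A) {t : ℕ} (ht : t < H) : ‖M.meanFeature π t‖ ≤ 1 := by
  have := M.isProbabilityMeasure_stateLaw π t ht
  simpa [meanFeature] using norm_integral_le_of_norm_le_const (μ := M.stateLaw π t ⊗ₘ π.ker t)
    (ae_of_all _ fun p => M.norm_φ_le t ht p.1 p.2)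

theorem occ_nonneg (π : Policy X A) {t : ℕ} (ht : t < H) (x : X t) : 0 ≤ M.occ π t x := by
  cases t with
  | zero => exact ENNReal.toReal_nonneg
  | succ t => exact integral_nonneg fun y => integral_nonneg fun a => M.density_nonneg t ht y a x

theorem occ_succ_le (π : Policy X A) {t : ℕ} (ht : t < H) (x : X (t + 1)) :
    M.occ π (t + 1) x ≤ ‖M.μ (t + 1) x‖ := by
  rw [M.occ_succ_eq_inner π ht]
  refine (real_inner_le_norm _ _).trans ?_
  exact mul_le_of_le_one_right (norm_nonneg _) (M.norm_meanFeature_le π ht)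

theorem norm_setIntegral_μ_le {t : ℕ} (ht : t < H) {s : Set (X t)} (hs : MeasurableSet s) :
    ‖∫ x in s, M.μ t x ∂(M.ν t)‖ ≤ √(d : ℝ) := by
  classical
  have hindicator (x : X t) : s.indicator (fun _ => (1 : ℝ)) x ∈ Set.Icc (0 : ℝ) 1 :=
    ⟨Set.indicator_nonneg (fun _ _ => zero_le_one) x,
      Set.indicator_le_self' (fun _ _ => zero_le_one) x⟩
  have := M.norm_μ_le t ht _ (measurable_const.indicator hs) hindicator
  simpa only [← Set.indicator_smul_left, one_smul, integral_indicator hs] using this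

theorem stateLaw_succ_real (π : Policy X A) {t : ℕ} (ht : t + 1 < H) {s : Set (X (t + 1))}
    (hs : MeasurableSet s) : (M.stateLaw π (t + 1)).real s =
      ∫ x in s, inner ℝ (M.μ (t + 1) x) (M.meanFeature π t) ∂(M.ν (t + 1)) := by
  have hocc := M.occ_succ_eq_inner π (by omega : t < H)
  rw [integral_eq_lintegral_of_nonneg_ae
      (ae_of_all _ fun x => (M.occ_nonneg π ht x).trans_eq (hocc x))
      ((M.integrable_μ (t + 1) ht).inner_const _).integrableOn.aestronglyMeasurable,
    ← withDensity_apply _ hs, measureReal_def, M.stateLaw_succ_eq_withDensity π t ht]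
  simp only [hocc]

theorem measurable_meanFeature_policy (P : PolicyDist X A) {t : ℕ} (ht : t < H) :
    Measurable fun θ => M.meanFeature (P.policy θ) t := by
  have hprob := fun θ => M.isProbabilityMeasure_stateLaw (P.policy θ) t ht
  let κ : Kernel P.Θ (X t) := ⟨_, M.measurable_stateLaw_policy P ht⟩
  have : IsMarkovKernel κ := ⟨hprob⟩
  have := P.markov t
  have hlaw (θ : P.Θ) :
      M.stateLaw (P.policy θ) t ⊗ₘ (P.policy θ).ker t = (κ ⊗ₖ P.ker t) θ :=
    (Kernel.compProd_apply_eq_compProd_sectR κ (P.ker t) θ).symm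
  simp only [meanFeature, hlaw]
  exact (M.measurable_φ t ht).stronglyMeasurable.integral_kernel.measurable

theorem measurable_occ_policy (P : PolicyDist X A) {t : ℕ} (ht : t + 1 < H) :
    Measurable fun p : P.Θ × X (t + 1) => M.occ (P.policy p.1) (t + 1) p.2 := by
  simp only [M.occ_succ_eq_inner _ (by omega : t < H)]
  exact ((M.measurable_μ (t + 1) ht).comp measurable_snd).inner
    ((M.measurable_meanFeature_policy P (by omega)).comp measurable_fst)

theorem mixLaw_succ_eq_withDensity (P : PolicyDist X A) {t : ℕ} (ht : t + 1 < H) :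
    M.mixLaw P (t + 1) = (M.ν (t + 1)).withDensity fun x =>
      ENNReal.ofReal (∫ θ, M.occ (P.policy θ) (t + 1) x ∂P.law) := by
  have := M.sigmaFinite_ν (t + 1) ht
  have hocc := M.measurable_occ_policy P ht
  ext s hs
  rw [mixLaw, Measure.bind_apply hs (M.measurable_stateLaw_policy P ht).aemeasurable,
    withDensity_apply _ hs]
  simp only [fun θ => M.stateLaw_succ_eq_withDensity (P.policy θ) t ht, withDensity_apply _ hs]
  rw [lintegral_lintegral_swap hocc.ennreal_ofReal.aemeasurable]
  refine lintegral_congr fun x => ?_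
  refine (ofReal_integral_eq_lintegral_ofReal ?_
    (ae_of_all _ fun θ => M.occ_nonneg _ ht x)).symm
  refine .of_bound (hocc.comp measurable_prodMk_right).aestronglyMeasurable ‖M.μ (t + 1) x‖
    (ae_of_all _ fun θ => ?_)
  rw [Real.norm_of_nonneg (M.occ_nonneg _ ht x)]
  exact M.occ_succ_le _ (by omega) x

end Occupancy

section Cover

/-- The states of layer `t` that `P` fails to cover with ratio `α` in comparison with `π`. -/
def uncovered (M : MDP X A d H) (P : PolicyDist X A) (α : ℝ) (π : Policy X A) (t : ℕ) :
    Set (X t) :=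
  {x | ∫ θ, M.occ (P.policy θ) t x ∂P.law < α * M.occ π t x}

variable (M : MDP X A d H) {P : PolicyDist X A} {α ε : ℝ} (π : Policy X A)

theorem uncovered_zero (hH : 0 < H) (hα : α ≤ 1) : M.uncovered P α π 0 = ∅ := by
  refine Set.eq_empty_of_forall_notMem fun x hx => ?_
  have hmean : ∫ θ, M.occ (P.policy θ) 0 x ∂P.law = M.occ π 0 x :=
    (integral_const (M.occ π 0 x)).trans (by simp)
  exact (mul_le_of_le_one_left (M.occ_nonneg π hH x) hα).not_gt (hmean.symm.trans_lt hx)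

theorem measurableSet_uncovered {t : ℕ} (ht : t < H) (hα : α ≤ 1) :
    MeasurableSet (M.uncovered P α π t) := by
  cases t with
  | zero =>
    rw [M.uncovered_zero π ht hα]
    exact .empty
  | succ t =>
    refine measurableSet_lt ?_ (.const_mul ?_ α)
    · exact (M.measurable_occ_policy P ht).stronglyMeasurable.integral_prod_left'.measurable
    · rw [funext (M.occ_succ_eq_inner π (by omega : t < H))]
      exact (M.measurable_μ (t + 1) ht).inner measurable_const

theorem stateLaw_restrict_compl_uncovered_le {t : ℕ} (ht : t < H) (hα : 0 < α) (hα1 : α ≤ 1) :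
    (M.stateLaw π t).restrict (M.uncovered P α π t)ᶜ ≤ ENNReal.ofReal α⁻¹ • M.mixLaw P t := by
  have hC := (M.measurableSet_uncovered (P := P) π ht hα1).compl
  cases t with
  | zero =>
    have hmix : M.mixLaw P 0 = M.stateLaw π 0 := (Measure.bind_const ..).trans (by simp; rfl)
    rw [hmix, M.uncovered_zero π ht hα1, Set.compl_empty, Measure.restrict_univ]
    exact Measure.le_iff'.2 fun s => le_mul_of_one_le_left' (ENNReal.one_le_ofReal.2
      ((one_le_inv₀ hα).2 hα1))
  | succ t =>
    have := M.sigmaFinite_ν (t + 1) ht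
    rw [M.mixLaw_succ_eq_withDensity P ht, M.stateLaw_succ_eq_withDensity π t ht, Measure.le_iff]
    intro s hs
    rw [Measure.restrict_apply hs, Measure.smul_apply, withDensity_apply _ (hs.inter hC),
      withDensity_apply _ hs, smul_eq_mul, ← lintegral_const_mul' _ _ ENNReal.ofReal_ne_top]
    refine (setLIntegral_mono' (hs.inter hC) fun x hx => ?_).trans
      (lintegral_mono_set Set.inter_subset_left)
    rw [← ENNReal.ofReal_mul (by positivity), ← div_eq_inv_mul]
    refine ENNReal.ofReal_le_ofReal ((le_div_iff₀' hα).2 ?_)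
    exact not_lt.1 hx.2

variable {M}

theorem IsPolicyCover.occ_succ_le_of_mem_uncovered {t : ℕ} (hcov : M.IsPolicyCover P α ε (t + 1))
    (ht : t < H) (hα : 0 ≤ α) {x : X (t + 1)} (hx : x ∈ M.uncovered P α π (t + 1)) :
    M.occ π (t + 1) x ≤ ε * ‖M.μ (t + 1) x‖ := by
  have hsup : M.occ π (t + 1) x ≤ ⨆ π' : Policy X A, M.occ π' (t + 1) x :=
    le_ciSup (f := fun π' => M.occ π' (t + 1) x)
      ⟨‖M.μ (t + 1) x‖, by rintro _ ⟨π', rfl⟩; exact M.occ_succ_le π' ht x⟩ π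
  by_contra! hlarge
  exact ((mul_le_mul_of_nonneg_left hsup hα).trans (hcov x (hlarge.le.trans hsup))).not_gt hx

theorem IsPolicyCover.stateLaw_real_uncovered_le {t : ℕ} (hcov : M.IsPolicyCover P α ε t)
    (ht : t < H) (hα : 0 ≤ α) (hα1 : α ≤ 1) (hε : 0 ≤ ε) :
    (M.stateLaw π t).real (M.uncovered P α π t) ≤
      ε * (d * √d) * (1 + (M.stateLaw π t).real (M.uncovered P α π t)) := by
  have hC := M.measurableSet_uncovered (P := P) π ht hα1
  cases t with
  | zero =>
    rw [M.uncovered_zero π ht hα1, measureReal_empty]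
    positivity
  | succ t =>
    have := M.sigmaFinite_ν (t + 1) ht
    have := M.isProbabilityMeasure_stateLaw π (t + 1) ht
    have hocc := M.occ_succ_eq_inner π (by omega : t < H)
    have hμ := M.integrable_μ (t + 1) ht
    have hreal {s} (hs : MeasurableSet s) := M.stateLaw_succ_real π ht hs
    have hvar : ∫ x in M.uncovered P α π (t + 1), ‖M.μ (t + 1) x‖ ∂(M.ν (t + 1)) ≤
        d * √d * (1 + (M.stateLaw π (t + 1)).real (M.uncovered P α π (t + 1))) := by
      rw [hreal hC]
      simpa only [finrank_euclideanSpace_fin] using setIntegral_norm_le_of_sqrt_finrank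
        (M.measurable_μ (t + 1) ht) hμ
        (fun s hs => (M.norm_setIntegral_μ_le ht hs).trans_eq (by rw [finrank_euclideanSpace_fin]))
        (M.norm_meanFeature_le π (by omega : t < H))
        (fun x => (M.occ_nonneg π ht x).trans_eq (hocc x))
        (by rw [← setIntegral_univ, ← hreal .univ, probReal_univ]) hC
    calc (M.stateLaw π (t + 1)).real (M.uncovered P α π (t + 1))
        = ∫ x in M.uncovered P α π (t + 1), M.occ π (t + 1) x ∂(M.ν (t + 1)) := by
          rw [hreal hC, funext hocc]
      _ ≤ ∫ x in M.uncovered P α π (t + 1), ε * ‖M.μ (t + 1) x‖ ∂(M.ν (t + 1)) := by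
          refine setIntegral_mono_on ?_ (hμ.norm.const_mul ε).integrableOn hC fun x hx =>
            hcov.occ_succ_le_of_mem_uncovered π (by omega) hα hx
          rw [funext hocc]
          exact (hμ.inner_const _).integrableOn
      _ ≤ _ := by
          rw [integral_const_mul, mul_assoc]
          exact mul_le_mul_of_nonneg_left hvar hε

end Cover

end MDP

theorem sum_range_le_mul_of_le_mul_one_add {p : ℕ → ℝ} {c : ℝ} {h : ℕ} (hp0 : p 0 = 0)
    (hp : ∀ t, t < h → 0 ≤ p t) (hpc : ∀ t, t < h → p t ≤ c * (1 + p t)) (hc : 0 ≤ c)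
    (hhc : h * c ≤ 1) : ∑ t ∈ Finset.range h, p t ≤ h * c := by
  rcases h with _ | _ | m
  · simp
  · simpa [hp0] using hc
  have hm : (0 : ℝ) < m + 1 := by positivity
  push_cast at hhc ⊢
  have hterm (t : ℕ) (ht : t ∈ Finset.range (m + 1)) : p (t + 1) ≤ (m + 1 + 1) * c / (m + 1) := by
    have hlt : t + 1 < m + 1 + 1 := by have := Finset.mem_range.1 ht; omega
    rw [le_div_iff₀ hm]
    nlinarith [hp _ hlt, hpc _ hlt, mul_le_mul_of_nonneg_right hhc (hp _ hlt)]
  rw [Finset.sum_range_succ', hp0, add_zero]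
  calc ∑ t ∈ Finset.range (m + 1), p (t + 1) ≤ (m + 1) * ((m + 1 + 1) * c / (m + 1)) := by
        simpa using Finset.sum_le_card_nsmul _ _ _ hterm
    _ = (m + 1 + 1) * c := mul_div_cancel₀ _ hm.ne'

namespace MDP

/-- The mean squared error of `g` as an estimate of the Q-function of `σ` in layer `t`, under the
law of the state-action pairs sampled by PSDP. -/
noncomputable def sqError [Fintype A] [Nonempty A] (M : MDP X A d H) (P : PolicyDist X A)
    (σ : Policy X A) (r : ∀ t, X t → A → ℝ) (h t : ℕ) (g : X t → A → ℝ) : ℝ :=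
  ∫ p, (g p.1 p.2 - M.Q σ r h t p.1 p.2) ^ 2
    ∂((M.mixLaw P t).prod (PMF.uniformOfFintype A).toMeasure)

section Advantage

variable [Fintype A] [MeasurableSingletonClass A] (M : MDP X A d H) {r : ∀ t, X t → A → ℝ} {h : ℕ}
  {π σ : Policy X A} {t : ℕ} {act : X t → A} {g : X t → A → ℝ}

theorem advantage_le_of_greedy (hσ : ∀ x, σ.ker t x = Measure.dirac (act x))
    (hact : ∀ x a, g x a ≤ g x (act x)) (x : X t) :
    M.advantage π σ r h t x ≤ 2 * √(∑ a, (g x a - M.Q σ r h t x a) ^ 2) := by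
  rw [advantage, stateValue, hσ, integral_dirac]
  exact integral_sub_le_of_greedy (hact x) (.of_finite)

theorem integral_advantage_le_of_greedy [Nonempty A] (hH : h ≤ H)
    (hr : ∀ t, t < h → Measurable fun p : X t × A => r t p.1 p.2) {S B : ℝ}
    (hS : M.ReturnsBoundedBy r h S) (ht : t < h)
    (hσ : ∀ x, σ.ker t x = Measure.dirac (act x)) (hact : ∀ x a, g x a ≤ g x (act x))
    (hg : Measurable fun p : X t × A => g p.1 p.2) (hgB : ∀ x a, |g x a| ≤ B)
    {P : PolicyDist X A} {α : ℝ} (hα : 0 < α) (hα1 : α ≤ 1) :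
    ∫ x, M.advantage π σ r h t x ∂(M.stateLaw π t) ≤
      2 * S * (M.stateLaw π t).real (M.uncovered P α π t) +
        2 * √(α⁻¹ * (Fintype.card A * M.sqError P σ r h t g)) := by
  have := M.isProbabilityMeasure_stateLaw π t (by omega)
  have := M.isProbabilityMeasure_mixLaw P (by omega : t < H)
  have hC := M.measurableSet_uncovered (P := P) π (by omega : t < H) hα1
  have hQ := M.measurable_Q hH hr σ ht
  have hgB' (x a) : |g x a| ≤ max B S := (hgB x a).trans (le_max_left ..)
  have hQB' (x a) : |M.Q σ r h t x a| ≤ max B S :=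
    (M.abs_Q_le hH hr hS σ ht x a).trans (le_max_right ..)
  have hE (m : Measure (X t)) [IsFiniteMeasure m] :
      Integrable (fun x => ∑ a, (g x a - M.Q σ r h t x a) ^ 2) m :=
    integrable_finsetSum _ fun a _ => integrable_sq_sub (hg.comp measurable_prodMk_right)
      (hQ.comp measurable_prodMk_right) (fun x => hgB' x a) (fun x => hQB' x a)
  have hadv : Integrable (M.advantage π σ r h t) (M.stateLaw π t) :=
    (M.integrable_integral_Q hH hr hS π σ ht _).sub (M.integrable_integral_Q hH hr hS σ σ ht _)
  have hcovered := setIntegral_sqrt_le hC.compl (inv_nonneg.2 hα.le)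
    (M.stateLaw_restrict_compl_uncovered_le π (by omega) hα hα1)
    (fun x => Finset.sum_nonneg fun a _ => sq_nonneg (g x a - M.Q σ r h t x a)) (hE _) (hE _)
  rw [integral_sum_eq_card_mul_integral_prod_uniform
    (integrable_sq_sub hg hQ (fun p => hgB' p.1 p.2) fun p => hQB' p.1 p.2)] at hcovered
  calc ∫ x, M.advantage π σ r h t x ∂(M.stateLaw π t)
      = ∫ x in M.uncovered P α π t, M.advantage π σ r h t x ∂(M.stateLaw π t) +
          ∫ x in (M.uncovered P α π t)ᶜ, M.advantage π σ r h t x ∂(M.stateLaw π t) :=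
        (integral_add_compl hC hadv).symm
    _ ≤ ∫ _ in M.uncovered P α π t, 2 * S ∂(M.stateLaw π t) +
          ∫ x in (M.uncovered P α π t)ᶜ, 2 * √(∑ a, (g x a - M.Q σ r h t x a) ^ 2)
            ∂(M.stateLaw π t) := by
        refine add_le_add (setIntegral_mono hadv.integrableOn (integrable_const _) fun x => ?_)
          (setIntegral_mono hadv.integrableOn ?_ (M.advantage_le_of_greedy hσ hact))
        · exact (le_abs_self _).trans (abs_sub_le_two_mul
            (M.abs_integral_Q_le hH hr hS π σ ht x) (M.abs_integral_Q_le hH hr hS σ σ ht x))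
        · exact ((integrable_sqrt (fun x => Finset.sum_nonneg fun a _ => sq_nonneg _)
            (hE _)).const_mul 2).integrableOn
    _ ≤ _ := by
        rw [setIntegral_const, smul_eq_mul, mul_comm, integral_const_mul]
        exact add_le_add le_rfl (mul_le_mul_of_nonneg_left hcovered zero_le_two)

end Advantage

section LayerRegression

variable [Fintype A] [Nonempty A] (M : MDP X A d H) {Ω Ω' : Type*} [MeasurableSpace Ω]
  [MeasurableSpace Ω'] {Pr : Measure Ω} [IsProbabilityMeasure Pr] {past : Ω → Ω'}
  {r : ∀ t, X t → A → ℝ} {h n t : ℕ} {pol : Ω' → Policy X A} {P : PolicyDist X A}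
  {data : Ω → Fin n → X t × A × ℝ}

theorem pi_sampleLaw_preimage_prodAssoc_symm (P : PolicyDist X A) (hH : h ≤ H) (ht : t < h)
    {K : Kernel (X t × A) ℝ} [IsMarkovKernel K] {σ : Policy X A}
    (hK : ∀ x a, K (x, a) = M.returnLaw σ r (h - 1 - t) t x a) {S : Set (Fin n → (X t × A) × ℝ)}
    (hS : MeasurableSet S) :
    Measure.pi (fun _ : Fin n => M.sampleLaw P σ r h t)
        ((fun z k => MeasurableEquiv.prodAssoc.symm (z k)) ⁻¹' S) =
      Measure.pi
        (fun _ : Fin n => (M.mixLaw P t).prod (PMF.uniformOfFintype A).toMeasure ⊗ₘ K) S := by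
  have := M.isProbabilityMeasure_mixLaw P (by omega : t < H)
  have hlaw := M.sampleLaw_eq_map_compProd P hH σ ht hK
  have : IsProbabilityMeasure (M.sampleLaw P σ r h t) := by
    rw [hlaw]; exact Measure.isProbabilityMeasure_map (by fun_prop)
  have hpres : MeasurePreserving MeasurableEquiv.prodAssoc.symm (M.sampleLaw P σ r h t)
      ((M.mixLaw P t).prod (PMF.uniformOfFintype A).toMeasure ⊗ₘ K) :=
    MeasurePreserving.symm MeasurableEquiv.prodAssoc ⟨by fun_prop, hlaw.symm⟩
  exact (measurePreserving_pi _ _ fun _ => hpres).measure_preimage hS.nullMeasurableSet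

theorem measure_not_sqError_le (hpast : Measurable past) (hH : h ≤ H) (hn : 1 ≤ n) (ht : t < h)
    (hr : ∀ t, t < h → Measurable fun p : X t × A => r t p.1 p.2)
    (hpol : ∀ ℓ, t < ℓ → ℓ < h → Measurable fun q : Ω' × X ℓ => (pol q.1).ker ℓ q.2)
    (hdata : Measurable data)
    (hlaw : ∀ E, MeasurableSet E → ∀ S, MeasurableSet S → Pr (past ⁻¹' E ∩ data ⁻¹' S) =
      ∫⁻ ω in past ⁻¹' E,
        Measure.pi (fun _ : Fin n => M.sampleLaw P (pol (past ω)) r h t) S ∂Pr)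
    {B : ℝ} (hB : 1 ≤ B) (hR : M.ReturnsBoundedBy r h B) {G : Set (X t → A → ℝ)}
    (hG : ∀ g ∈ G, Measurable fun p : X t × A => g p.1 p.2) (hGB : ∀ g ∈ G, ∀ x a, |g x a| ≤ B)
    (hreal : ∀ π : Policy X A, M.Q π r h t ∈ G) (hcov : coveringNumber G (1 / n) ≠ ⊤)
    {ghat : Ω → X t → A → ℝ} (hghat : ∀ ω, ghat ω ∈ G)
    (hmin : ∀ ω, ∀ g ∈ G, ∑ i, (ghat ω (data ω i).1 (data ω i).2.1 - (data ω i).2.2) ^ 2 ≤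
      ∑ i, (g (data ω i).1 (data ω i).2.1 - (data ω i).2.2) ^ 2) (L : ℝ) :
    Pr {ω | ¬ (n * M.sqError P (pol (past ω)) r h t (ghat ω) ≤ 40 * B ^ 2 + 128 * B ^ 2 * L)} ≤
      (coveringNumber G (1 / n)).toNat * ENNReal.ofReal (Real.exp (-L)) := by
  have := M.isProbabilityMeasure_mixLaw P (by omega : t < H)
  obtain ⟨K, _, hK⟩ := M.exists_kernel_eq_returnLaw hH hr (h - 1 - t) t (by omega) hpol
  obtain ⟨c, hcG, hnet⟩ := exists_net_of_coveringNumber_ne_top hcov ⟨_, hreal (unifPolicy X A)⟩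
  let pairs (ω : Ω) (k : Fin n) : (X t × A) × ℝ := MeasurableEquiv.prodAssoc.symm (data ω k)
  have hreassoc : Measurable fun (z : Fin n → X t × A × ℝ) k =>
      MeasurableEquiv.prodAssoc.symm (z k) := by fun_prop
  have hpairs (E) (hE : MeasurableSet E) (S) (hS : MeasurableSet S) :
      Pr (past ⁻¹' E ∩ pairs ⁻¹' S) = ∫⁻ ω in past ⁻¹' E, Measure.pi (fun _ : Fin n =>
        (M.mixLaw P t).prod (PMF.uniformOfFintype A).toMeasure ⊗ₘ K.sectR (past ω)) S ∂Pr := by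
    refine (hlaw E hE _ (hreassoc hS)).trans (lintegral_congr fun ω => ?_)
    exact M.pi_sampleLaw_preimage_prodAssoc_symm P hH ht (K := K.sectR (past ω))
      (fun x a => hK (past ω) x a) hS
  have hfail := measure_not_isConcentrated_le (L := L) (g := fun i w => c i w.1 w.2) hpast
    (hreassoc.comp hdata) hpairs (by linarith) (fun v => by rw [hK]; exact hR t ht _ _ _)
    (fun i => hG _ (hcG i)) fun i w => hGB _ (hcG i) w.1 w.2
  refine le_trans (measure_mono ?_) hfail
  intro ω hω hconc
  simp only [hK] at hconc
  obtain ⟨i, hi⟩ := hnet _ (hghat ω)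
  exact hω <| hconc.integral_sq_sub_le hn hB (fun i => hG _ (hcG i)) (hG _ (hreal _))
    (hG _ (hghat ω)) (fun i w => hGB _ (hcG i) w.1 w.2) (fun w => hGB _ (hreal _) w.1 w.2)
    (fun w => hGB _ (hghat ω) w.1 w.2) (hmin ω _ (hreal _))
    ⟨i, fun w => (hi w.1 w.2).trans_eq (by ring)⟩

end LayerRegression

end MDP

theorem natCast_mul_ofReal_exp_neg_log_add {N : ℕ} (hN : 1 ≤ N) {x : ℝ} (hx : 0 < x) :
    N * ENNReal.ofReal (Real.exp (-(Real.log N + Real.log x))) = ENNReal.ofReal x⁻¹ := by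
  have hN' : (0 : ℝ) < N := by exact_mod_cast hN
  rw [← Real.log_mul hN'.ne' hx.ne', Real.exp_neg, Real.exp_log (by positivity),
    ← ENNReal.ofReal_natCast, ← ENNReal.ofReal_mul hN'.le, mul_inv, mul_inv_cancel_left₀ hN'.ne']

theorem two_mul_le_mul_sqrt {α B a n H L : ℝ} (hα : 0 < α) (hα1 : α ≤ 1) (ha : 1 ≤ a)
    (hn : 0 < n) (hH : 0 < H) (hnH : n ≤ H ^ 2) (hL : Real.log 2 ≤ L) :
    2 * B ≤ 30 * H * √(α⁻¹ * B ^ 2 * a * n⁻¹ * L) := by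
  have hL' : 1 / 2 ≤ L := by linarith [Real.log_two_gt_d9]
  have hsq : (B / (2 * H)) ^ 2 ≤ α⁻¹ * B ^ 2 * a * n⁻¹ * L := calc
    (B / (2 * H)) ^ 2 = 1 * B ^ 2 * 1 * (H ^ 2)⁻¹ * (1 / 4) := by field_simp; norm_num
    _ ≤ α⁻¹ * B ^ 2 * a * n⁻¹ * L := by
      gcongr
      · exact (one_le_inv₀ hα).2 hα1
      · linarith
  calc 2 * B ≤ 2 * |B| := by gcongr; exact le_abs_self B
    _ ≤ 15 * |B| := by linarith [abs_nonneg B]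
    _ = 30 * H * |B / (2 * H)| := by
      rw [abs_div, abs_of_pos (by positivity : 0 < 2 * H)]; field_simp; ring
    _ ≤ 30 * H * √(α⁻¹ * B ^ 2 * a * n⁻¹ * L) := by gcongr; exact Real.abs_le_sqrt hsq

theorem two_mul_sqrt_two_hundred_mul_le (α B a n L : ℝ) :
    2 * √(α⁻¹ * (a * (200 * B ^ 2 * L / n))) ≤ 30 * √(α⁻¹ * B ^ 2 * a * n⁻¹ * L) := by
  have h200 : √(200 : ℝ) ≤ 15 := Real.sqrt_le_iff.2 (by norm_num)
  calc 2 * √(α⁻¹ * (a * (200 * B ^ 2 * L / n)))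
      = 2 * (√200 * √(α⁻¹ * B ^ 2 * a * n⁻¹ * L)) := by
        rw [← Real.sqrt_mul (by norm_num)]; ring_nf
    _ ≤ 2 * (15 * √(α⁻¹ * B ^ 2 * a * n⁻¹ * L)) := by gcongr
    _ = 30 * √(α⁻¹ * B ^ 2 * a * n⁻¹ * L) := by ring

theorem rpow_three_halves {x : ℝ} (hx : 0 ≤ x) : x ^ (3 / 2 : ℝ) = x * √x := by
  rw [Real.rpow_div_two_eq_sqrt _ hx, Real.rpow_ofNat, pow_succ, Real.sq_sqrt hx]

theorem ofReal_one_sub_le_of_compl {Ω : Type*} [MeasurableSpace Ω] {Pr : Measure Ω}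
    [IsProbabilityMeasure Pr] {δ : ℝ} {s : Set Ω} (hδ : 0 ≤ δ)
    (hs : Pr sᶜ ≤ ENNReal.ofReal δ) : ENNReal.ofReal (1 - δ) ≤ Pr s := by
  rw [ENNReal.ofReal_sub _ hδ, ENNReal.ofReal_one, tsub_le_iff_right, ← measure_univ (μ := Pr),
    ← Set.union_compl_self s]
  exact (measure_union_le _ _).trans (by gcongr)

theorem ofReal_one_sub_le_of_forall {Ω : Type*} [MeasurableSpace Ω] {Pr : Measure Ω}
    [IsProbabilityMeasure Pr] {δ : ℝ} {s : Set Ω} (hδ : 0 ≤ δ) (hs : ∀ ω, ω ∈ s) :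
    ENNReal.ofReal (1 - δ) ≤ Pr s := by
  rw [Set.eq_univ_of_forall hs, measure_univ, ENNReal.ofReal_le_one]
  linarith

theorem MDP.value_le_value_add_two_mul (M : MDP X A d H) {r : ∀ t, X t → A → ℝ} {h : ℕ} {B : ℝ}
    (hH : h ≤ H) (hr : ∀ t, t < h → Measurable fun p : X t × A => r t p.1 p.2)
    (hB : M.ReturnsBoundedBy r h B) (h1 : 1 ≤ h) (π σ : Policy X A) :
    M.value π r h ≤ M.value σ r h + 2 * B := by
  linarith [(abs_le.1 (M.abs_value_le hH hr hB π h1)).2,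
    (abs_le.1 (M.abs_value_le hH hr hB σ h1)).1]

namespace PSDPRun

variable [Fintype A] [Nonempty A] {M : MDP X A d H} {h : ℕ} {r : ∀ t, X t → A → ℝ}
  {G : ∀ t, Set (X t → A → ℝ)} {P : ℕ → PolicyDist X A} {n : ℕ} {Ω : Type*}
  [mΩ : MeasurableSpace Ω] {Pr : Measure Ω} (run : PSDPRun M h r G P n Pr)

theorem hist_antitone : Antitone run.hist := antitone_nat_of_succ_le run.hist_succ_le

theorem output_ker (ω : Ω) (t : ℕ) (x : X t) :
    (run.output ω).ker t x = Measure.dirac (run.act t ω x) :=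
  Kernel.deterministic_apply (run.measurable_act t ω) x

theorem measurable_output_ker {t ℓ : ℕ} (hℓ : t ≤ ℓ) :
    @Measurable (Ω × X ℓ) (Measure A) ((run.hist t).prod inferInstance) _
      fun q => (run.output q.1).ker ℓ q.2 := by
  simp only [output_ker]
  exact Measure.measurable_dirac.comp <| (run.measurable_act_uncurry ℓ).mono
    (sup_le_sup_right (MeasurableSpace.comap_mono (run.hist_antitone hℓ)) _) le_rfl

section Regression

variable {B δ : ℝ}

theorem measure_not_sqError_le [IsProbabilityMeasure Pr] (hH : h ≤ H) (hn : 1 ≤ n)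
    (hr : ∀ t, t < h → Measurable fun p : X t × A => r t p.1 p.2) (hB : 1 ≤ B)
    (hG : ∀ t, t < h → ∀ g ∈ G t, Measurable fun p : X t × A => g p.1 p.2)
    (hreal : M.Realizes G r h) (hGB : ∀ t, t < h → ∀ g ∈ G t, ∀ x a, |g x a| ≤ B)
    (hR : M.ReturnsBoundedBy r h B)
    (hcov : ∀ t, t < h → coveringNumber (G t) (1 / n) ≠ ⊤) (t : Fin h) (L : ℝ) :
    Pr {ω | ¬ (n * M.sqError (P t) (run.output ω) r h t (run.ghat t ω) ≤
        40 * B ^ 2 + 128 * B ^ 2 * L)} ≤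
      (coveringNumber (G t) (1 / n)).toNat * ENNReal.ofReal (Real.exp (-L)) :=
  -- `run.hist (t + 1)` is the σ-algebra of the past: `id` maps `Ω` to this coarser space.
  @MDP.measure_not_sqError_le X _ A _ d H _ _ M Ω Ω mΩ (run.hist (t + 1)) Pr _ id r h n t
    run.output (P t) (run.data t) (measurable_id'' (run.hist_le _)) hH hn t.2 hr
    (fun _ hℓ _ => run.measurable_output_ker hℓ)
    ((run.measurable_data t).mono (run.hist_le t) le_rfl) (run.data_law t) B hB hR (G t)
    (hG t t.2) (hGB t t.2) (hreal t t.2) (hcov t t.2) (run.ghat t) (run.ghat_mem t) (run.ghat_le t)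
    L

theorem measure_not_sqError_le_complexity [IsProbabilityMeasure Pr] (hH : h ≤ H) (hn : 1 ≤ n)
    (hr : ∀ t, t < h → Measurable fun p : X t × A => r t p.1 p.2) (hB : 1 ≤ B)
    (hG : ∀ t, t < h → ∀ g ∈ G t, Measurable fun p : X t × A => g p.1 p.2)
    (hreal : M.Realizes G r h) (hGB : ∀ t, t < h → ∀ g ∈ G t, ∀ x a, |g x a| ≤ B)
    (hR : M.ReturnsBoundedBy r h B)
    (hcov : ∀ t, t < h → coveringNumber (G t) (1 / n) ≠ ⊤) (hδ : 0 < δ) (hnδ : 2 * δ ≤ n)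
    (t : Fin h) :
    Pr {ω | ¬ (n * M.sqError (P t) (run.output ω) r h t (run.ghat t ω) ≤
        200 * B ^ 2 * complexity G h n δ)} ≤ ENNReal.ofReal (δ / n) := by
  have hN := one_le_toNat_coveringNumber (hcov t t.2) ⟨_, hreal t t.2 (unifPolicy X A)⟩
  have hfail := run.measure_not_sqError_le hH hn hr hB hG hreal hGB hR hcov t
    (Real.log (coveringNumber (G t) (1 / n)).toNat + Real.log (n / δ))
  rw [natCast_mul_ofReal_exp_neg_log_add hN (div_pos (by exact_mod_cast hn) hδ), inv_div] at hfail
  refine le_trans (measure_mono ?_) hfail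
  intro ω hω hsmall
  refine hω (hsmall.trans ?_)
  have hΛ : 5 / 9 ≤ complexity G h n δ :=
    le_trans (by linarith [Real.log_two_gt_d9]) (log_two_le_complexity hδ hnδ)
  calc 40 * B ^ 2 + 128 * B ^ 2 *
        (Real.log (coveringNumber (G t) (1 / n)).toNat + Real.log (n / δ))
      ≤ 40 * B ^ 2 + 128 * B ^ 2 * complexity G h n δ := by
        gcongr; exact log_coveringNumber_add_le_complexity t
    _ ≤ 200 * B ^ 2 * complexity G h n δ := by nlinarith [sq_nonneg B]

theorem measure_not_forall_sqError_le_complexity [IsProbabilityMeasure Pr] (hH : h ≤ H)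
    (hn : 1 ≤ n) (hr : ∀ t, t < h → Measurable fun p : X t × A => r t p.1 p.2) (hB : 1 ≤ B)
    (hG : ∀ t, t < h → ∀ g ∈ G t, Measurable fun p : X t × A => g p.1 p.2)
    (hreal : M.Realizes G r h) (hGB : ∀ t, t < h → ∀ g ∈ G t, ∀ x a, |g x a| ≤ B)
    (hR : M.ReturnsBoundedBy r h B)
    (hcov : ∀ t, t < h → coveringNumber (G t) (1 / n) ≠ ⊤) (hδ : 0 < δ) (hnδ : 2 * δ ≤ n)
    (hhn : h ≤ n) :
    Pr {ω | ¬ ∀ t : Fin h, n * M.sqError (P t) (run.output ω) r h t (run.ghat t ω) ≤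
        200 * B ^ 2 * complexity G h n δ} ≤ ENNReal.ofReal δ := by
  simp only [not_forall, Set.ofPred_exists]
  calc Pr (⋃ t : Fin h, _) ≤ ∑ _t : Fin h, ENNReal.ofReal (δ / n) :=
        (measure_iUnion_fintype_le _ _).trans <| Finset.sum_le_sum fun t _ =>
          run.measure_not_sqError_le_complexity hH hn hr hB hG hreal hGB hR hcov hδ hnδ t
    _ = ENNReal.ofReal (h * (δ / n)) := by
        rw [Finset.sum_const, Finset.card_univ, Fintype.card_fin, nsmul_eq_mul,
          ENNReal.ofReal_mul h.cast_nonneg, ENNReal.ofReal_natCast]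
    _ ≤ ENNReal.ofReal δ := by
        refine ENNReal.ofReal_le_ofReal ?_
        rw [mul_div_left_comm]
        exact mul_le_of_le_one_right hδ.le (div_le_one_of_le₀ (by exact_mod_cast hhn) n.cast_nonneg)

end Regression

section Regret

variable [MeasurableSingletonClass A] {α ε B S : ℝ}

theorem value_le_of_forall_sqError_le (hH : h ≤ H) (h1 : 1 ≤ h) (hα : 0 < α) (hα1 : α ≤ 1)
    (hε : 0 ≤ ε) (hr : ∀ t, t < h → Measurable fun p : X t × A => r t p.1 p.2)
    (hS : M.ReturnsBoundedBy r h S) (hS0 : 0 ≤ S)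
    (hG : ∀ t, t < h → ∀ g ∈ G t, Measurable fun p : X t × A => g p.1 p.2)
    (hGB : ∀ t, t < h → ∀ g ∈ G t, ∀ x a, |g x a| ≤ B)
    (hcover : ∀ t, t < h → M.IsPolicyCover (P t) α ε t) {ω : Ω} {e : ℝ}
    (he : ∀ t : Fin h, M.sqError (P t) (run.output ω) r h t (run.ghat t ω) ≤ e)
    (π : Policy X A) :
    M.value π r h ≤ M.value (run.output ω) r h + h * (2 * √(α⁻¹ * (Fintype.card A * e))) +
      2 * S * (h * (ε * (d * √d))) := by
  rcases lt_or_ge 1 (h * (ε * (d * √d))) with hlarge | hsmall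
  · have : 2 * S ≤ 2 * S * (h * (ε * (d * √d))) :=
      le_mul_of_one_le_right (by positivity) hlarge.le
    have : 0 ≤ h * (2 * √(α⁻¹ * (Fintype.card A * e))) := by positivity
    linarith [M.value_le_value_add_two_mul hH hr hS h1 π (run.output ω)]
  let p (t : ℕ) := (M.stateLaw π t).real (M.uncovered (P t) α π t)
  have hp : ∑ t ∈ Finset.range h, p t ≤ h * (ε * (d * √d)) := by
    refine sum_range_le_mul_of_le_mul_one_add ?_ (fun _ _ => measureReal_nonneg)
      (fun t ht => (hcover t ht).stateLaw_real_uncovered_le π (by omega) hα.le hα1 hε)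
      (by positivity) hsmall
    simp only [p, M.uncovered_zero π (by omega : 0 < H) hα1, measureReal_empty]
  have hlayer (t) (ht : t ∈ Finset.range h) :
      ∫ x, M.advantage π (run.output ω) r h t x ∂(M.stateLaw π t) ≤
        2 * S * p t + 2 * √(α⁻¹ * (Fintype.card A * e)) := by
    have ht' := Finset.mem_range.1 ht
    have hmem := run.ghat_mem ⟨t, ht'⟩ ω
    refine (M.integral_advantage_le_of_greedy hH hr hS ht' (run.output_ker ω t)
      (run.ghat_act ⟨t, ht'⟩ ω) (hG t ht' _ hmem) (hGB t ht' _ hmem) (P := P t) hα hα1).trans ?_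
    gcongr
    exact he ⟨t, ht'⟩
  have hsum := Finset.sum_le_sum hlayer
  rw [← M.value_sub_value_eq_sum_integral_advantage hH hr hS π (run.output ω) h1,
    Finset.sum_add_distrib, ← Finset.mul_sum, Finset.sum_const, Finset.card_range,
    nsmul_eq_mul] at hsum
  linarith [mul_le_mul_of_nonneg_left hp (by positivity : 0 ≤ 2 * S)]

theorem value_le_of_forall_mul_sqError_le (hH : h ≤ H) (h1 : 1 ≤ h) (hn : 1 ≤ n) (hα : 0 < α)
    (hα1 : α ≤ 1) (hε : 0 ≤ ε) (hr : ∀ t, t < h → Measurable fun p : X t × A => r t p.1 p.2)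
    (hS : M.ReturnsBoundedBy r h S) (hS0 : 0 ≤ S)
    (hG : ∀ t, t < h → ∀ g ∈ G t, Measurable fun p : X t × A => g p.1 p.2)
    (hGB : ∀ t, t < h → ∀ g ∈ G t, ∀ x a, |g x a| ≤ B)
    (hcover : ∀ t, t < h → M.IsPolicyCover (P t) α ε t) {ω : Ω} {L : ℝ}
    (herr : ∀ t : Fin h,
      n * M.sqError (P t) (run.output ω) r h t (run.ghat t ω) ≤ 200 * B ^ 2 * L)
    (π : Policy X A) :
    M.value π r h ≤ M.value (run.output ω) r h
      + 30 * H * √(α⁻¹ * B ^ 2 * Fintype.card A * (n : ℝ)⁻¹ * L)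
      + 2 * ε * h * (d * √d) * S := by
  have hn0 : (0 : ℝ) < n := by exact_mod_cast hn
  have hstat : h * (2 * √(α⁻¹ * (Fintype.card A * (200 * B ^ 2 * L / n)))) ≤
      H * (30 * √(α⁻¹ * B ^ 2 * Fintype.card A * (n : ℝ)⁻¹ * L)) :=
    mul_le_mul (by exact_mod_cast hH) (two_mul_sqrt_two_hundred_mul_le ..) (by positivity)
      H.cast_nonneg
  linarith [run.value_le_of_forall_sqError_le hH h1 hα hα1 hε hr hS hS0 hG hGB hcover
    (fun t => (le_div_iff₀' hn0).2 (herr t)) π]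

end Regret

end PSDPRun

end LowRank

open LowRank

theorem mainTheorem10 :
    ∃ c : ℝ, 0 < c ∧
      ∀ (X : ℕ → Type*) [∀ t, MeasurableSpace (X t)]
        (A : Type*) [Fintype A] [Nonempty A] [MeasurableSpace A] [MeasurableSingletonClass A]
        (d H : ℕ) (M : LowRank.MDP X A d H)
        (α δ ε B : ℝ) (Bd : ℕ → ℝ) (h n : ℕ)
        (r : ∀ t, X t → A → ℝ) (G : ∀ t, Set (X t → A → ℝ)) (P : ℕ → LowRank.PolicyDist X A)
        (Ω : Type*) [MeasurableSpace Ω] (Pr : Measure Ω) [IsProbabilityMeasure Pr]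
        (run : LowRank.PSDPRun M h r G P n Pr),
        0 < α → α < 1 → 0 < δ → δ < 1 → 0 < ε → ε < 1 → 1 ≤ B → 1 ≤ h → h ≤ H →
        1 ≤ n → 2 * δ ≤ n →
        (∀ t, t < h → 0 < Bd t) →
        (∀ t, t < h → Measurable fun p : X t × A => r t p.1 p.2) →
        (∀ t, t < h → ∀ x a, |r t x a| ≤ Bd t) →
        (∀ t, t < h → ∀ g ∈ G t, Measurable fun p : X t × A => g p.1 p.2) →
        M.Realizes G r h →
        (∀ t, t < h → ∀ g ∈ G t, ∀ x a, |g x a| ≤ B) →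
        (∀ t, t < h → ∀ (π : LowRank.Policy X A) (x : X t) (a : A),
          ∀ᵐ R ∂(M.returnLaw π r (h - 1 - t) t x a), |R| ≤ B) →
        (∀ t, t < h → LowRank.coveringNumber (G t) (1 / n) ≠ ⊤) →
        (∀ t, t < h → M.IsPolicyCover (P t) α ε t) →
        ENNReal.ofReal (1 - δ) ≤ Pr {ω | ∀ π : LowRank.Policy X A,
          M.value π r h ≤ M.value (run.output ω) r h
            + c * H * √(α⁻¹ * B ^ 2 * Fintype.card A * (n : ℝ)⁻¹ *
                ((⨆ t : Fin h, Real.log (LowRank.coveringNumber (G t) (1 / n)).toNat)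
                  + Real.log (n / δ)))
            + 2 * ε * h * (d : ℝ) ^ (3 / 2 : ℝ) * ∑ t ∈ Finset.range h, Bd t} := by
  refine ⟨30, by norm_num, ?_⟩
  intro X _ A _ _ _ _ d H M α δ ε B Bd h n r G P Ω _ Pr _ run hα hα1 hδ _ hε _ hB h1 hH hn hnδ
    hBd0 hr hBd hG hreal hGB hR hcov hcover
  have hBd0' (t) (ht : t < h) : 0 ≤ Bd t := (hBd0 t ht).le
  have hS0 : 0 ≤ ∑ t ∈ Finset.range h, Bd t :=
    Finset.sum_nonneg fun t ht => hBd0' t (Finset.mem_range.1 ht)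
  rw [rpow_three_halves d.cast_nonneg]
  rcases le_or_gt n (H ^ 2) with hnH | hHn
  · have hBsqrt : 2 * B ≤ 30 * H * √(α⁻¹ * B ^ 2 * Fintype.card A * (n : ℝ)⁻¹ *
        complexity G h n δ) :=
      two_mul_le_mul_sqrt hα hα1.le (by exact_mod_cast Fintype.card_pos) (by exact_mod_cast hn)
        (by exact_mod_cast h1.trans hH) (by exact_mod_cast hnH) (log_two_le_complexity hδ hnδ)
    refine ofReal_one_sub_le_of_forall hδ.le fun ω π => ?_
    refine (M.value_le_value_add_two_mul hH hr hR h1 π (run.output ω)).trans ?_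
    exact (add_le_add_right hBsqrt _).trans (le_add_of_nonneg_right (by positivity))
  · have hhn : h ≤ n := hH.trans ((Nat.le_self_pow two_ne_zero H).trans hHn.le)
    refine ofReal_one_sub_le_of_compl hδ.le <| le_trans (measure_mono ?_) <|
      run.measure_not_forall_sqError_le_complexity hH hn hr hB hG hreal hGB hR hcov hδ hnδ hhn
    intro ω hω herr
    exact hω <| run.value_le_of_forall_mul_sqError_le hH h1 hn hα hα1.le hε.le hr
      (M.returnsBoundedBy_sum hH hr hBd hBd0') hS0 hG hGB hcover herr
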